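/- Let $0\le k\le n$ be integers. A dotted crossingless matching with $2n$ endpoints and $k$ dots is a crossingless matching of the points $1<\dots<2n$ on a line (a perfect matching by arcs $(e_1,e_2)$, $e_1<e_2$, no two of which satisfy $e_1<f_1<e_2<f_2$) together with a choice of $k$ of its $n$ arcs, called dotted. An arc $(e_1,e_2)$ is outer if there is no arc $(f_1,f_2)$ of the matching with $f_1<e_1$ and $e_2<f_2$. Let $\widetilde R^q_{n,k}$ be the free $\mathbb Z[q,q^{-1}]$-module on these diagrams. Let $\alpha,\beta$ be crossingless matchings whose arcs are identical except that, for some points $a<b<c<d$, $\alpha$ has the arcs $(a,b),(c,d)$ and $\beta$ has the arcs $(a,d),(b,c)$. Let $D$ be a set of common arcs of $\alpha$ and $\beta$ away from $a,b,c,d$, and write $\alpha^{u,v,\dots}$ (resp. $\beta^{u,v,\dots}$) for the matching $\alpha$ (resp. $\beta$) with dots exactly on the arcs in $D\cup\{u,v,\dots\}$. Let $x_1,\dots,x_r$, numbered from innermost to outermost, be all the arcs $(e_1,e_2)\notin D$ of $\alpha$ with $e_1<a$ and $d<e_2$, and let $n_i$ be the number of arcs in $D$ that are nested inside $x_i=(x_{i_1},x_{i_2})$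 and enclose $a$ and $d$, i.e. of $(y_1,y_2)\in D$ with $x_{i_1}<y_1<a$ and $d<y_2<x_{i_2}$. The quantum Russell relations are, for all such data, $$\text{(Type I, } |D|=k-1)\qquad \beta^{(b,c)}=\alpha^{(a,b)}+\alpha^{(c,d)}+q^{-1}\beta^{(a,d)}+(1-q^{-2})\sum_{i=1}^{r}q^{\,i-n_i}\,\alpha^{x_i},$$ $$\text{(Type II, } |D|=k-2)\qquad \alpha^{(a,b),(c,d)}=\beta^{(a,d),(b,c)}+(1-q^{-2})\sum_{i=1}^{r}q^{\,i-n_i-1}\,\beta^{(a,d),x_i}.$$ The quantum Russell space $R^q_{n,k}$ is the quotient of $\widetilde R^q_{n,k}$ by the submodule spanned by all these relations. Then the classes of the dotted crossingless matchings with $k$ dots all of which lie on outer arcs form a basis of $R^q_{n,k}$ as a $\mathbb Z[q,q^{-1}]$-module (in particular $R^q_{n,k}$ is free), and its rank is $$\operatorname{rank} R^q_{n,k}=\binom{2n}{n+k}-\binom{2n}{n+k+1}=\frac{2k+1}{n+k+1}\binom{2n}{n+k}.$$ -/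

import Mathlib

open scoped LaurentPolynomial

namespace QuantumRussell

/-- An arc on the `2n` fixed points of a line: the pair (left endpoint, right endpoint). -/
abbrev Arc (n : ℕ) : Type := Fin (2 * n) × Fin (2 * n)

/-- The arc `f` encloses the arc `e` (that is, `e` is nested inside `f`). -/
def Encloses {n : ℕ} (f e : Arc n) : Prop := f.1 < e.1 ∧ e.2 < f.2

instance {n : ℕ} (f e : Arc n) : Decidable (Encloses f e) :=
  inferInstanceAs (Decidable (_ ∧ _))

/-- A crossingless matching of `2n` fixed points on a line. -/
structure CrossinglessMatching (n : ℕ) where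
  /-- the set of arcs -/
  arcs : Finset (Arc n)
  /-- arcs are written with the left endpoint first -/
  fst_lt_snd : ∀ e ∈ arcs, e.1 < e.2
  /-- every fixed point is an endpoint of exactly one arc -/
  existsUnique_arc : ∀ p : Fin (2 * n), ∃! e : Arc n, e ∈ arcs ∧ (p = e.1 ∨ p = e.2)
  /-- no two arcs cross -/
  not_cross : ∀ e ∈ arcs, ∀ f ∈ arcs, ¬ (e.1 < f.1 ∧ f.1 < e.2 ∧ e.2 < f.2)

/-- A crossingless matching of `2n` points decorated with `k` dots, at most one on each arc;
`dots` is the set of dotted arcs. -/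
structure DottedMatching (n k : ℕ) extends CrossinglessMatching n where
  /-- the set of dotted arcs -/
  dots : Finset (Arc n)
  dots_subset : dots ⊆ arcs
  card_dots : dots.card = k

/-- All dots lie on outer arcs, i.e. on arcs that are not nested inside any other arc. -/
def DottedMatching.DotsOnOuterArcs {n k : ℕ} (m : DottedMatching n k) : Prop :=
  ∀ e ∈ m.dots, ∀ f ∈ m.arcs, ¬ Encloses f e

/-- The free `ℤ[q, q⁻¹]`-module on the dotted crossingless matchings of `2n` points with `k` dots.
The Laurent monomial `q ^ j` is `LaurentPolynomial.T j`. -/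
abbrev FreeSpace (n k : ℕ) : Type := DottedMatching n k →₀ ℤ[T;T⁻¹]

open Classical in
/-- The generator given by the crossingless matching `α` with dots exactly on the arcs in `S`.
(It is `0` if `S` is not a set of `k` arcs of `α`; this never happens in the relations below.) -/
noncomputable def diagram {n : ℕ} (k : ℕ) (α : CrossinglessMatching n) (S : Finset (Arc n)) :
    FreeSpace n k :=
  if h : S ⊆ α.arcs ∧ S.card = k then
    Finsupp.single { α with dots := S, dots_subset := h.1, card_dots := h.2 } 1
  else 0

/-- `α` and `β` have identical arcs, except that for the points `a < b < c < d`, `α` has the arcs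
`(a,b)` and `(c,d)` while `β` has the arcs `(a,d)` and `(b,c)`. -/
structure IsSurgery {n : ℕ} (α β : CrossinglessMatching n) (a b c d : Fin (2 * n)) : Prop where
  a_lt_b : a < b
  b_lt_c : b < c
  c_lt_d : c < d
  ab_mem : (a, b) ∈ α.arcs
  cd_mem : (c, d) ∈ α.arcs
  ad_mem : (a, d) ∈ β.arcs
  bc_mem : (b, c) ∈ β.arcs
  rest_eq : α.arcs \ {(a, b), (c, d)} = β.arcs \ {(a, d), (b, c)}

/-- The set `{x₁, …, x_α}` of all undotted arcs `(e₁, e₂)` of the matching with `e₁ < a` and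
`d < e₂`, where `D` is the set of dotted arcs. -/
def undottedAround {n : ℕ} (α : CrossinglessMatching n) (D : Finset (Arc n))
    (a d : Fin (2 * n)) : Finset (Arc n) :=
  (α.arcs \ D).filter fun e => Encloses e (a, d)

/-- The index `i ≥ 1` of the arc `x = x_i`, where the undotted arcs around `(a, d)` are numbered
from the innermost, `x₁`, to the outermost. -/
def level {n : ℕ} (α : CrossinglessMatching n) (D : Finset (Arc n)) (a d : Fin (2 * n))
    (x : Arc n) : ℕ :=
  ((undottedAround α D a d).filter fun e => e = x ∨ Encloses x e).card

/-- The number `n_i` of dotted arcs `(y₁, y₂)` that lie between `(a, d)` and `x = x_i`: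
`x.1 < y₁ < a` and `d < y₂ < x.2`. -/
def dottedBetween {n : ℕ} (D : Finset (Arc n)) (a d : Fin (2 * n)) (x : Arc n) : ℕ :=
  (D.filter fun y => Encloses x y ∧ Encloses y (a, d)).card

/-- The Type I quantum Russell relation (left side minus right side)
`β^{bc} = α^{ab} + α^{cd} + q⁻¹ β^{ad} + (1 - q⁻²) ∑ᵢ q^{i - nᵢ} α^{xᵢ}`,
where a superscript is the arc that is dotted in addition to the common dotted arcs `D`. -/
noncomputable def typeI {n : ℕ} (k : ℕ) (α β : CrossinglessMatching n) (a b c d : Fin (2 * n))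
    (D : Finset (Arc n)) : FreeSpace n k :=
  diagram k β (insert (b, c) D)
    - (diagram k α (insert (a, b) D) + diagram k α (insert (c, d) D)
      + (LaurentPolynomial.T (-1) : ℤ[T;T⁻¹]) • diagram k β (insert (a, d) D)
      + ∑ x ∈ undottedAround α D a d,
          ((1 - LaurentPolynomial.T (-2)) *
            LaurentPolynomial.T ((level α D a d x : ℤ) - dottedBetween D a d x) : ℤ[T;T⁻¹]) •
              diagram k α (insert x D))

/-- The Type II quantum Russell relation (left side minus right side)
`α^{ab,cd} = β^{ad,bc} + (1 - q⁻²) ∑ᵢ q^{i - nᵢ - 1} β^{ad,xᵢ}`,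
where the superscripts are the arcs that are dotted in addition to the common dotted arcs `D`. -/
noncomputable def typeII {n : ℕ} (k : ℕ) (α β : CrossinglessMatching n) (a b c d : Fin (2 * n))
    (D : Finset (Arc n)) : FreeSpace n k :=
  diagram k α (insert (a, b) (insert (c, d) D))
    - (diagram k β (insert (a, d) (insert (b, c) D))
      + ∑ x ∈ undottedAround α D a d,
          ((1 - LaurentPolynomial.T (-2)) *
            LaurentPolynomial.T ((level α D a d x : ℤ) - dottedBetween D a d x - 1) : ℤ[T;T⁻¹]) •
              diagram k β (insert (a, d) (insert x D)))

/-- All Type I and Type II quantum Russell relations in `FreeSpace n k`. Here `D` is the set of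
dotted arcs away from `a, b, c, d`, common to all diagrams of the relation. -/
inductive Relation (n k : ℕ) : FreeSpace n k → Prop
  | typeI (α β : CrossinglessMatching n) (a b c d : Fin (2 * n)) (D : Finset (Arc n))
      (hs : IsSurgery α β a b c d) (hD : D ⊆ α.arcs \ {(a, b), (c, d)}) (hk : D.card + 1 = k) :
      Relation n k (typeI k α β a b c d D)
  | typeII (α β : CrossinglessMatching n) (a b c d : Fin (2 * n)) (D : Finset (Arc n))
      (hs : IsSurgery α β a b c d) (hD : D ⊆ α.arcs \ {(a, b), (c, d)}) (hk : D.card + 2 = k) :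
      Relation n k (typeII k α β a b c d D)

/-- The submodule spanned by the quantum Russell relations. -/
noncomputable def relations (n k : ℕ) : Submodule ℤ[T;T⁻¹] (FreeSpace n k) :=
  Submodule.span ℤ[T;T⁻¹] {r | Relation n k r}

/-- The quantum Russell space `R^q_{n,k}`. -/
abbrev RussellSpace (n k : ℕ) : Type := FreeSpace n k ⧸ relations n k

/-- The class of a dotted crossingless matching in the quantum Russell space. -/
noncomputable def cls {n k : ℕ} (m : DottedMatching n k) : RussellSpace n k :=
  (relations n k).mkQ (Finsupp.single m 1)

end QuantumRussell

/-!
The upper bound on the rank is a rewriting argument, the lower bound comes from an explicit linear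
invariant of dotted matchings.

**Spanning.** Let a dotted arc `(b, c)` be nested, and let `(a, d)` be the innermost arc around it.
If `(a, d)` is undotted, the Type I relation, otherwise the Type II relation, expresses the diagram
through diagrams in which the sum of the depths of the dotted arcs is smaller
(`mkQ_diagram_mem_span`). Hence the diagrams with dots on outer arcs span.

**The invariant.** Let `W` be the free `ℤ[q, q⁻¹]`-algebra on two letters `0` and `1`. On the
polynomial ring `W[X]` there are linear operators `U` (`plainWrap`) and `D` (`dottedWrap`) with
`U(w) = q·1w0 - 0w1` and `D(w) = 0w0 + X·0w1` for `w ∈ W`, and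
`U(X f) = q X U(f) + (q - q⁻¹) D(f)`, `D(X f) = q⁻¹ X D(f)` for all `f`. A dotted matching has a
weight in `W[X]`: an undotted arc acts by `U` on the weight of what lies under it, a dotted arc
by `D`, and adjacent diagrams are multiplied. For all `f, g, h ∈ W[X]`

* `U(f D(g) h) = D(f) g U(h) + U(f) g D(h) + q⁻¹ D(f U(g) h) + X U(f) g U(h)`,
* `D(f) g D(h) = D(f D(g) h) + q⁻¹ X D(f U(g) h)`

(`plainWrap_mul_dottedWrap_mul`, `dottedWrap_mul_mul_dottedWrap`). These are the quantum Russell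
relations without surrounding arcs, up to a multiple of `X`. When the factor `X` is moved out
through the surrounding arcs, the rules for `U(X f)` and `D(X f)` multiply it by `q` for each
undotted and by `q⁻¹` for each dotted arc, and each undotted arc `x` leaves behind the diagram in
which `x` is dotted: this is the correction sum `(1 - q⁻²) ∑ q^(i - nᵢ) α^{xᵢ}`
(`Framed.eq_add_sum`). So the constant term of the weight vanishes on all relations
(`eval_eq_zero`).

**Independence.** If all dots lie on outer arcs, the lexicographically smallest word in the constant
term of the weight has the letter `1` exactly at the right endpoints of the undotted arcs
(`leads_constTerm_weight`), and these determine the diagram (`eq_of_closers_eq`). So the constant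
terms are linearly independent.

**The rank.** The sets of right endpoints of undotted arcs are the sets of `n - k` of the `2n`
points that contain at most half of the points of every initial segment (`card_dotsOnOuterArcs`),
and these are counted by a ballot number (`card_ballot_succ_add`).
-/

/-! ### The two operators -/

namespace QuantumRussell
open Polynomial

/-- The free `ℤ[q, q⁻¹]`-algebra on two letters `false` and `true`, which stand for `0` and `1`. -/
def WordAlgebra : Type := MonoidAlgebra ℤ[T;T⁻¹] (FreeMonoid Bool)

noncomputable instance : Ring WordAlgebra :=
  inferInstanceAs (Ring (MonoidAlgebra ℤ[T;T⁻¹] (FreeMonoid Bool)))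

noncomputable instance : Algebra ℤ[T;T⁻¹] WordAlgebra :=
  inferInstanceAs (Algebra ℤ[T;T⁻¹] (MonoidAlgebra ℤ[T;T⁻¹] (FreeMonoid Bool)))

/-- A letter of the word algebra. -/
noncomputable def letter (b : Bool) : WordAlgebra :=
  MonoidAlgebra.of ℤ[T;T⁻¹] _ (FreeMonoid.of b)

/-- The map `x ↦ b x c` that puts a letter on either side. -/
noncomputable def sandwich (b c : Bool) : WordAlgebra →ₗ[ℤ[T;T⁻¹]] WordAlgebra :=
  LinearMap.mulLeftRight _ (letter b, letter c)

theorem sandwich_apply (b c : Bool) (x : WordAlgebra) :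
    sandwich b c x = letter b * x * letter c := rfl

/-- Monomials in the central variable, as a map that is linear over `ℤ[q, q⁻¹]`. -/
noncomputable def monomialMap (j : ℕ) : WordAlgebra →ₗ[ℤ[T;T⁻¹]] WordAlgebra[X] :=
  (Polynomial.monomial j).restrictScalars _

theorem monomialMap_apply (j : ℕ) (x : WordAlgebra) : monomialMap j x = monomial j x := rfl

/-- The operator `D` of a dotted arc: `X ^ j * w` goes to
`q ^ (-j) * (X ^ j * 0w0 + X ^ (j + 1) * 0w1)`. -/
noncomputable def dottedWrap : WordAlgebra[X] →ₗ[ℤ[T;T⁻¹]] WordAlgebra[X] :=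
  Polynomial.lsum fun j =>
    (LaurentPolynomial.T (-j) : ℤ[T;T⁻¹]) •
      (monomialMap j ∘ₗ sandwich false false + monomialMap (j + 1) ∘ₗ sandwich false true)

/-- The operator `U` of an undotted arc: `X ^ j * w` goes to
`q ^ (j + 1) * X ^ j * 1w0 - q ^ (-j) * X ^ j * 0w1 + (q ^ j - q ^ (-j)) * X ^ (j - 1) * 0w0`.
For `j = 0` the last coefficient is zero, so the truncated exponent does not matter. -/
noncomputable def plainWrap : WordAlgebra[X] →ₗ[ℤ[T;T⁻¹]] WordAlgebra[X] :=
  Polynomial.lsum fun j =>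
    (LaurentPolynomial.T (j + 1) : ℤ[T;T⁻¹]) • (monomialMap j ∘ₗ sandwich true false)
      - (LaurentPolynomial.T (-j) : ℤ[T;T⁻¹]) • (monomialMap j ∘ₗ sandwich false true)
      + (LaurentPolynomial.T j - LaurentPolynomial.T (-j) : ℤ[T;T⁻¹]) •
        (monomialMap (j - 1) ∘ₗ sandwich false false)

theorem dottedWrap_monomial (j : ℕ) (x : WordAlgebra) :
    dottedWrap (monomial j x) = (LaurentPolynomial.T (-j) : ℤ[T;T⁻¹]) •
      (monomial j (sandwich false false x) + monomial (j + 1) (sandwich false true x)) := by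
  simp [dottedWrap, Polynomial.lsum_apply, Polynomial.sum_monomial_index, monomialMap_apply]

theorem plainWrap_monomial (j : ℕ) (x : WordAlgebra) :
    plainWrap (monomial j x) =
      (LaurentPolynomial.T (j + 1) : ℤ[T;T⁻¹]) • monomial j (sandwich true false x)
      - (LaurentPolynomial.T (-j) : ℤ[T;T⁻¹]) • monomial j (sandwich false true x)
      + (LaurentPolynomial.T j - LaurentPolynomial.T (-j) : ℤ[T;T⁻¹]) •
        monomial (j - 1) (sandwich false false x) := by
  simp [plainWrap, Polynomial.lsum_apply, Polynomial.sum_monomial_index, monomialMap_apply]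

theorem dottedWrap_C (x : WordAlgebra) :
    dottedWrap (C x) = C (sandwich false false x) + X * C (sandwich false true x) := by
  rw [← monomial_zero_left, dottedWrap_monomial]
  simp [X_mul_monomial, ← monomial_zero_left]

theorem plainWrap_C (x : WordAlgebra) :
    plainWrap (C x) = (LaurentPolynomial.T 1 : ℤ[T;T⁻¹]) • C (sandwich true false x)
      - C (sandwich false true x) := by
  rw [← monomial_zero_left, plainWrap_monomial]
  simp [← monomial_zero_left]

theorem dottedWrap_X_mul (f : WordAlgebra[X]) :
    dottedWrap (X * f) = (LaurentPolynomial.T (-1) : ℤ[T;T⁻¹]) • (X * dottedWrap f) := by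
  induction f using Polynomial.induction_on' with
  | add p q hp hq => simp only [mul_add, map_add, hp, hq, smul_add]
  | monomial j x =>
    rw [X_mul_monomial, dottedWrap_monomial, dottedWrap_monomial, mul_smul_comm, smul_smul,
      ← LaurentPolynomial.T_add, mul_add, X_mul_monomial, X_mul_monomial]
    congr 2; push_cast; ring

theorem plainWrap_X_mul (f : WordAlgebra[X]) :
    plainWrap (X * f) = (LaurentPolynomial.T 1 : ℤ[T;T⁻¹]) • (X * plainWrap f)
      + (LaurentPolynomial.T 1 - LaurentPolynomial.T (-1) : ℤ[T;T⁻¹]) • dottedWrap f := by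
  induction f using Polynomial.induction_on' with
  | add p q hp hq => simp only [mul_add, map_add, hp, hq, smul_add]; abel
  | monomial j x =>
    have h0 : (LaurentPolynomial.T j - LaurentPolynomial.T (-j) : ℤ[T;T⁻¹]) •
        (X * monomial (j - 1) (sandwich false false x)) =
        (LaurentPolynomial.T j - LaurentPolynomial.T (-j) : ℤ[T;T⁻¹]) •
          monomial j (sandwich false false x) := by
      rcases j with _ | j
      · simp
      · rw [X_mul_monomial]; rfl
    rw [X_mul_monomial, plainWrap_monomial, plainWrap_monomial, dottedWrap_monomial, mul_add,
      mul_sub, mul_smul_comm, mul_smul_comm, mul_smul_comm, h0, X_mul_monomial, X_mul_monomial]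
    simp only [smul_add, smul_sub, smul_smul, sub_smul, sub_mul,
      ← LaurentPolynomial.T_add, Nat.add_sub_cancel, Nat.cast_add, Nat.cast_one]
    have e1 : (1 + (-j : ℤ)) = 1 - j := by ring
    have e2 : (-1 + (-j : ℤ)) = -(j + 1) := by ring
    have e3 : (1 + (j + 1) : ℤ) = j + 1 + 1 := by ring
    have e4 : (1 + (j) : ℤ) = j + 1 := by ring
    rw [e1, e2, e3, e4]
    abel

theorem C_mul_X_mul (a : WordAlgebra) (f : WordAlgebra[X]) : C a * (X * f) = X * (C a * f) := by
  rw [← mul_assoc, ← X_mul, mul_assoc]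

theorem mul_X_mul (g f : WordAlgebra[X]) : g * (X * f) = X * (g * f) := by
  rw [← mul_assoc, ← X_mul, mul_assoc]

theorem induction_X_mul {P : WordAlgebra[X] → Prop} (f : WordAlgebra[X])
    (hC : ∀ a, P (C a)) (hX : ∀ f, P f → P (X * f)) (hadd : ∀ f g, P f → P g → P (f + g)) :
    P f := by
  induction f using Polynomial.induction_on' with
  | add p q hp hq => exact hadd _ _ hp hq
  | monomial j x =>
    induction j with
    | zero => exact hC x
    | succ j ih => rw [← X_mul_monomial]; exact hX _ ih

theorem T_neg_one_mul : (LaurentPolynomial.T (-1) : ℤ[T;T⁻¹]) * LaurentPolynomial.T 1 = 1 := by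
  rw [← LaurentPolynomial.T_add]; simp

theorem dottedWrap_mul_X_mul (f g : WordAlgebra[X]) :
    dottedWrap f * (X * g) = X * (dottedWrap f * g) := mul_X_mul _ _

theorem plainWrap_mul_X_mul (f g : WordAlgebra[X]) :
    plainWrap f * (X * g) = X * (plainWrap f * g) := mul_X_mul _ _

/-- The Type II relation without surrounding arcs, up to a multiple of `X`. -/
theorem dottedWrap_mul_mul_dottedWrap (f g h : WordAlgebra[X]) :
    dottedWrap f * g * dottedWrap h = dottedWrap (f * dottedWrap g * h)
      + (LaurentPolynomial.T (-1) : ℤ[T;T⁻¹]) • (X * dottedWrap (f * plainWrap g * h)) := by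
  have hpq := T_neg_one_mul
  induction f using induction_X_mul with
  | hadd f f' hf hf' => simp only [map_add, add_mul, mul_add, smul_add, hf, hf']; abel
  | hX f hf =>
    simp only [mul_assoc] at hf
    simp only [dottedWrap_X_mul, smul_mul_assoc, mul_assoc, hf, mul_add, smul_add, mul_smul_comm]
  | hC f =>
  induction g using induction_X_mul with
  | hadd f f' hf hf' => simp only [map_add, add_mul, mul_add, smul_add, hf, hf']; abel
  | hX g hf =>
    simp only [mul_assoc] at hf
    simp only [dottedWrap_X_mul, plainWrap_X_mul, smul_mul_assoc, mul_assoc, C_mul_X_mul,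
      dottedWrap_mul_X_mul, hf, add_mul, mul_add, smul_add, mul_smul_comm, map_smul, map_add]
    match_scalars <;> grind
  | hC g =>
  induction h using induction_X_mul with
  | hadd f f' hf hf' => simp only [map_add, mul_add, smul_add, hf, hf']; abel
  | hX h hf =>
    simp only [mul_assoc] at hf
    simp only [dottedWrap_X_mul, mul_assoc, C_mul_X_mul,
      dottedWrap_mul_X_mul, plainWrap_mul_X_mul, hf, mul_add, smul_add, mul_smul_comm]
  | hC h =>
    simp only [dottedWrap_C, plainWrap_C, mul_add, add_mul, mul_sub, sub_mul, mul_assoc,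
      smul_mul_assoc, mul_smul_comm, C_mul_X_mul, ← C_mul, map_add, map_sub, map_smul,
      dottedWrap_X_mul, sandwich_apply]
    match_scalars <;> grind

/-- The Type I relation without surrounding arcs, up to a multiple of `X`. -/
theorem plainWrap_mul_dottedWrap_mul (f g h : WordAlgebra[X]) :
    plainWrap (f * dottedWrap g * h) =
      dottedWrap f * g * plainWrap h + plainWrap f * g * dottedWrap h
      + (LaurentPolynomial.T (-1) : ℤ[T;T⁻¹]) • dottedWrap (f * plainWrap g * h)
      + X * (plainWrap f * g * plainWrap h) := by
  have hpq := T_neg_one_mul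
  have hII := dottedWrap_mul_mul_dottedWrap
  simp only [mul_assoc] at hII
  induction f using induction_X_mul with
  | hadd f f' hf hf' => simp only [map_add, add_mul, mul_add, smul_add, hf, hf']; abel
  | hX f hf =>
    simp only [mul_assoc] at hf
    simp only [dottedWrap_X_mul, plainWrap_X_mul, smul_mul_assoc, mul_assoc, hf, hII, mul_add,
      add_mul, smul_add, mul_smul_comm]
    match_scalars <;> grind
  | hC f =>
  induction g using induction_X_mul with
  | hadd f f' hf hf' => simp only [map_add, add_mul, mul_add, smul_add, hf, hf']; abel
  | hX g hf =>
    simp only [mul_assoc] at hf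
    simp only [dottedWrap_X_mul, plainWrap_X_mul, smul_mul_assoc, mul_assoc, C_mul_X_mul,
      dottedWrap_mul_X_mul, plainWrap_mul_X_mul, hf, add_mul, mul_add, smul_add,
      mul_smul_comm, map_smul, map_add]
    match_scalars <;> grind
  | hC g =>
  induction h using induction_X_mul with
  | hadd f f' hf hf' => simp only [map_add, mul_add, smul_add, hf, hf']; abel
  | hX h hf =>
    simp only [mul_assoc] at hf
    simp only [dottedWrap_X_mul, plainWrap_X_mul, mul_assoc, C_mul_X_mul,
      dottedWrap_mul_X_mul, plainWrap_mul_X_mul, hf, hII, mul_add, smul_add,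
      mul_smul_comm]
    match_scalars <;> grind
  | hC h =>
    simp only [dottedWrap_C, plainWrap_C, mul_add, add_mul, mul_sub, sub_mul, mul_assoc,
      smul_mul_assoc, mul_smul_comm, C_mul_X_mul, ← C_mul, map_add, map_sub, map_smul,
      plainWrap_X_mul, sandwich_apply]
    match_scalars <;> grind
end QuantumRussell

/-! ### Intervals of points and the weight of a diagram -/

namespace QuantumRussell
open Polynomial

namespace CrossinglessMatching

variable {n : ℕ} (α : CrossinglessMatching n)

theorem exists_arc (p : Fin (2 * n)) : ∃ e ∈ α.arcs, p = e.1 ∨ p = e.2 :=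
  (α.existsUnique_arc p).exists

variable {α}

theorem eq_of_endpoint {e f : Arc n} (he : e ∈ α.arcs) (hf : f ∈ α.arcs) {p : Fin (2 * n)}
    (hpe : p = e.1 ∨ p = e.2) (hpf : p = f.1 ∨ p = f.2) : e = f :=
  (α.existsUnique_arc p).unique ⟨he, hpe⟩ ⟨hf, hpf⟩

theorem eq_of_fst {e f : Arc n} (he : e ∈ α.arcs) (hf : f ∈ α.arcs) (h : e.1 = f.1) : e = f :=
  eq_of_endpoint he hf (Or.inl rfl) (Or.inl h)

theorem eq_of_snd {e f : Arc n} (he : e ∈ α.arcs) (hf : f ∈ α.arcs) (h : e.2 = f.2) : e = f :=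
  eq_of_endpoint he hf (Or.inr rfl) (Or.inr h)

theorem fst_ne_snd {e f : Arc n} (he : e ∈ α.arcs) (hf : f ∈ α.arcs) : e.1 ≠ f.2 := by
  intro h
  have hef := eq_of_endpoint he hf (Or.inl rfl) (Or.inr h)
  subst hef
  exact (α.fst_lt_snd e he).ne h

/-- An arc with an endpoint strictly between the endpoints of `f` is nested in `f`. -/
theorem encloses_of_endpoint {e f : Arc n} (he : e ∈ α.arcs) (hf : f ∈ α.arcs) {p : Fin (2 * n)}
    (hp : p = e.1 ∨ p = e.2) (h1 : f.1 < p) (h2 : p < f.2) : Encloses f e := by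
  have hlt := α.fst_lt_snd e he
  have c1 := α.not_cross e he f hf
  have c2 := α.not_cross f hf e he
  have n1 := fst_ne_snd he hf
  have n2 := fst_ne_snd hf he
  have hne : e ≠ f := by rintro rfl; rcases hp with rfl | rfl <;> simp at *
  have n3 : e.1 ≠ f.1 := fun h => hne (eq_of_fst he hf h)
  have n4 : e.2 ≠ f.2 := fun h => hne (eq_of_snd he hf h)
  unfold Encloses
  rcases hp with rfl | rfl <;> simp only [Fin.lt_def, Ne, Fin.ext_iff] at * <;> omega

theorem encloses_of_lt {e f : Arc n} (he : e ∈ α.arcs) (hf : f ∈ α.arcs) (h1 : f.1 < e.1)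
    (h2 : e.1 < f.2) : Encloses f e := encloses_of_endpoint he hf (Or.inl rfl) h1 h2

/-- The interval `[i, j)` of points is a union of arcs of `α` together with their endpoints. -/
def Closes (α : CrossinglessMatching n) (i j : ℕ) : Prop :=
  ∀ e ∈ α.arcs, (i ≤ e.1 ∧ (e.1 : ℕ) < j) ↔ (i ≤ e.2 ∧ (e.2 : ℕ) < j)

theorem closes_univ (α : CrossinglessMatching n) : α.Closes 0 (2 * n) := fun e _ => by
  simp

theorem Closes.inside {e : Arc n} (he : e ∈ α.arcs) : α.Closes (e.1 + 1) e.2 := by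
  intro f hf
  have a1 := @encloses_of_endpoint n α f e hf he f.1 (Or.inl rfl)
  have a2 := @encloses_of_endpoint n α f e hf he f.2 (Or.inr rfl)
  unfold Encloses at a1 a2
  simp only [Fin.lt_def] at *
  constructor
  · rintro ⟨h1, h2⟩
    have := a1 (by omega) (by omega); have := α.fst_lt_snd f hf; simp only [Fin.lt_def] at *; omega
  · rintro ⟨h1, h2⟩
    have := a2 (by omega) (by omega); have := α.fst_lt_snd f hf; simp only [Fin.lt_def] at *; omega

theorem Closes.arc {e : Arc n} (he : e ∈ α.arcs) : α.Closes e.1 (e.2 + 1) := by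
  intro f hf
  have a0 := Closes.inside he f hf
  have n1 := fst_ne_snd he hf
  have n2 := fst_ne_snd hf he
  have hlt := α.fst_lt_snd e he
  by_cases hef : f = e
  · subst hef; simp only [Fin.lt_def] at *; omega
  have n3 : e.1 ≠ f.1 := fun h => hef (eq_of_fst he hf h).symm
  have n4 : e.2 ≠ f.2 := fun h => hef (eq_of_snd he hf h).symm
  simp only [Fin.lt_def, Ne, Fin.ext_iff] at *
  omega

theorem Closes.tail {i m j : ℕ} (h1 : α.Closes i m) (h2 : α.Closes i j) (him : i ≤ m) :
    α.Closes m j := by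
  intro e he
  have := h1 e he
  have := h2 e he
  omega

theorem Closes.exists_arc {i j : ℕ} (h : α.Closes i j) (hij : i < j) (hj : j ≤ 2 * n) :
    ∃ e ∈ α.arcs, (e.1 : ℕ) = i ∧ (e.2 : ℕ) < j := by
  obtain ⟨e, he, hp⟩ := α.exists_arc ⟨i, by omega⟩
  have hlt := α.fst_lt_snd e he
  have := h e he
  refine ⟨e, he, ?_⟩
  simp only [Fin.lt_def, Fin.ext_iff] at *
  omega

theorem Closes.after {i j : ℕ} (h : α.Closes i j) {e : Arc n} (he : e ∈ α.arcs)
    (hi : (e.1 : ℕ) = i) : α.Closes (e.2 + 1) j := by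
  have hlt := α.fst_lt_snd e he
  simp only [Fin.lt_def] at hlt
  subst hi
  exact (Closes.arc he).tail h (by omega)

end CrossinglessMatching

open CrossinglessMatching

variable {n : ℕ}

/-- The operator of the arc `e`, where `S` is the set of dotted arcs. -/
noncomputable def wrap (S : Finset (Arc n)) (e : Arc n) :
    WordAlgebra[X] →ₗ[ℤ[T;T⁻¹]] WordAlgebra[X] :=
  if e ∈ S then dottedWrap else plainWrap

/-- The value in `WordAlgebra[X]` of the part of the diagram with arcs `α` and dotted arcs `S` that
lies over the points in `[i, j)`: an arc acts on the value of the diagram below it, and diagrams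
side by side are multiplied. The value is `1` at a point `i` that is not the left endpoint of an arc
lying over `[i, j)`; if no arc leaves the interval, this happens only for the empty interval. -/
noncomputable def weight (α : CrossinglessMatching n) (S : Finset (Arc n)) (i j : ℕ) :
    WordAlgebra[X] :=
  if h : ∃ e ∈ α.arcs, (e.1 : ℕ) = i ∧ (e.2 : ℕ) < j then
    wrap S h.choose (weight α S (i + 1) h.choose.2) * weight α S (h.choose.2 + 1) j
  else 1
termination_by j - i
decreasing_by
  all_goals
    have := h.choose_spec
    have := α.fst_lt_snd _ this.1
    simp only [Fin.lt_def] at *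
    omega

theorem weight_arc {α : CrossinglessMatching n} (S : Finset (Arc n)) {e : Arc n}
    (he : e ∈ α.arcs) {i j : ℕ} (hi : (e.1 : ℕ) = i) (hj : (e.2 : ℕ) < j) :
    weight α S i j = wrap S e (weight α S (i + 1) e.2) * weight α S (e.2 + 1) j := by
  have h : ∃ e ∈ α.arcs, (e.1 : ℕ) = i ∧ (e.2 : ℕ) < j := ⟨e, he, hi, hj⟩
  have hc : h.choose = e :=
    eq_of_fst h.choose_spec.1 he (Fin.ext (by rw [h.choose_spec.2.1, hi]))
  rw [weight, dif_pos h, hc]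

theorem weight_of_le (α : CrossinglessMatching n) (S : Finset (Arc n)) {i j : ℕ} (h : j ≤ i) :
    weight α S i j = 1 := by
  rw [weight, dif_neg]
  rintro ⟨e, he, h1, h2⟩
  have := α.fst_lt_snd _ he
  simp only [Fin.lt_def] at *
  omega

theorem weight_congr {α β : CrossinglessMatching n} {S S' : Finset (Arc n)} {i j : ℕ}
    (h : ∀ e : Arc n, i ≤ e.1 → e.1 < e.2 → (e.2 : ℕ) < j →
      (e ∈ α.arcs ↔ e ∈ β.arcs) ∧ (e ∈ α.arcs → (e ∈ S ↔ e ∈ S'))) :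
    weight α S i j = weight β S' i j := by
  by_cases hex : ∃ e ∈ α.arcs, (e.1 : ℕ) = i ∧ (e.2 : ℕ) < j
  · obtain ⟨e, he, hi, hj⟩ := hex
    have hlt := α.fst_lt_snd _ he
    simp only [Fin.lt_def] at hlt
    have he' := h e hi.ge (α.fst_lt_snd _ he) hj
    rw [weight_arc S he hi hj, weight_arc S' (he'.1.1 he) hi hj,
      weight_congr (i := i + 1) fun f h1 h12 h2 => h f (by omega) h12 (by omega),
      weight_congr (i := e.2 + 1) fun f h1 h12 h2 => h f (by omega) h12 (by omega)]
    simp only [wrap, he'.2 he]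
  · have hex' : ¬ ∃ e ∈ β.arcs, (e.1 : ℕ) = i ∧ (e.2 : ℕ) < j := by
      rintro ⟨e, he, hi, hj⟩
      exact hex ⟨e, (h e hi.ge (β.fst_lt_snd _ he) hj).1.2 he, hi, hj⟩
    rw [weight, weight, dif_neg hex, dif_neg hex']
termination_by j - i

theorem weight_mul {α : CrossinglessMatching n} (S : Finset (Arc n)) {i m j : ℕ}
    (h : α.Closes i m) (him : i ≤ m) (hmj : m ≤ j) (hm : m ≤ 2 * n) :
    weight α S i j = weight α S i m * weight α S m j := by
  rcases him.eq_or_lt with rfl | him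
  · rw [weight_of_le α S le_rfl, one_mul]
  · obtain ⟨e, he, hi, hj⟩ := h.exists_arc him hm
    have hlt := α.fst_lt_snd _ he
    simp only [Fin.lt_def] at hlt
    rw [weight_arc S he hi (hj.trans_le hmj), weight_arc S he hi hj, mul_assoc,
      ← weight_mul S (h.after he hi) (by omega) hmj hm]
termination_by j - i
end QuantumRussell

/-! ### Moving the central variable through the surrounding arcs -/

namespace QuantumRussell
open Polynomial
open CrossinglessMatching

variable {n : ℕ}

/-- `V i j` is built from the value `V a (d + 1)` in the same way as `weight γ D i j` is built
from `weight γ D a (d + 1)`. -/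
structure Framed (γ : CrossinglessMatching n) (D : Finset (Arc n)) (a d : Fin (2 * n))
    (V : ℕ → ℕ → WordAlgebra[X]) : Prop where
  left : ∀ e ∈ γ.arcs, ∀ j : ℕ, e.2 < a → (d : ℕ) < j →
    V e.1 j = wrap D e (weight γ D (e.1 + 1) e.2) * V (e.2 + 1) j
  around : ∀ e ∈ γ.arcs, ∀ j : ℕ, Encloses e (a, d) → (e.2 : ℕ) < j →
    V e.1 j = wrap D e (V (e.1 + 1) e.2) * weight γ D (e.2 + 1) j
  start : ∀ j : ℕ, (d : ℕ) < j → V a j = V a (d + 1) * weight γ D (d + 1) j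

namespace Framed

variable {γ : CrossinglessMatching n} {D : Finset (Arc n)} {a d : Fin (2 * n)}
  {V W : ℕ → ℕ → WordAlgebra[X]}

theorem sub (hV : Framed γ D a d V) (hW : Framed γ D a d W) :
    Framed γ D a d (fun i j => V i j - W i j) where
  left e he j h1 h2 := by rw [hV.left e he j h1 h2, hW.left e he j h1 h2, mul_sub]
  around e he j h1 h2 := by
    rw [hV.around e he j h1 h2, hW.around e he j h1 h2, map_sub, sub_mul]
  start j h := by rw [hV.start j h, hW.start j h, sub_mul]

theorem smul (c : ℤ[T;T⁻¹]) (hV : Framed γ D a d V) :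
    Framed γ D a d (fun i j => c • V i j) where
  left e he j h1 h2 := by rw [hV.left e he j h1 h2, mul_smul_comm]
  around e he j h1 h2 := by rw [hV.around e he j h1 h2, map_smul, smul_mul_assoc]
  start j h := by rw [hV.start j h, smul_mul_assoc]

theorem of_weight {β : CrossinglessMatching n} {S : Finset (Arc n)} (had : a < d)
    (hc : β.Closes a (d + 1))
    (h : ∀ e : Arc n, e.1 < a ∨ d < e.1 →
      (e ∈ β.arcs ↔ e ∈ γ.arcs) ∧ (e ∈ β.arcs → (e ∈ S ↔ e ∈ D))) :
    Framed γ D a d (weight β S) where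
  left e he j h1 h2 := by
    have hlt := γ.fst_lt_snd _ he
    have hw := h e (Or.inl (hlt.trans h1))
    have heβ := hw.1.2 he
    rw [weight_arc S heβ rfl (by simp only [Fin.lt_def] at *; omega)]
    simp only [wrap, hw.2 heβ]
    congr 2
    refine weight_congr fun f hf1 hf12 hf2 => h f (Or.inl ?_)
    simp only [Fin.lt_def] at *; omega
  around e he j h1 h2 := by
    have hw := h e (Or.inl h1.1)
    have heβ := hw.1.2 he
    rw [weight_arc S heβ rfl h2]
    simp only [wrap, hw.2 heβ]
    congr 1
    refine weight_congr fun f hf1 hf12 hf2 => h f (Or.inr ?_)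
    have := h1.2
    simp only [Fin.lt_def] at *; omega
  start j hj := by
    rw [weight_mul S hc (by simp only [Fin.lt_def] at *; omega) hj (by omega)]
    congr 1
    exact weight_congr fun f hf1 hf12 hf2 => h f (Or.inr hf1)

end Framed

/-- If `[e.1, j)` starts with an arc `e` around `(a, d)`, the arcs around `(a, d)` over this
interval are `e` and those nested in `e`. -/
theorem mem_between_iff {γ : CrossinglessMatching n} {a d : Fin (2 * n)} (had : a < d)
    {e x : Arc n} (he : e ∈ γ.arcs) (hea : Encloses e (a, d)) (hx : x ∈ γ.arcs)
    (hxa : Encloses x (a, d)) {j : ℕ} (hj : (e.2 : ℕ) < j) :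
    ((e.1 : ℕ) ≤ x.1 ∧ (x.2 : ℕ) < j) ↔ x = e ∨ ((e.1 : ℕ) + 1 ≤ x.1 ∧ (x.2 : ℕ) < e.2) := by
  have := @encloses_of_lt n γ x e hx he
  have hne : (x.1 : ℕ) = e.1 → x = e := fun h => eq_of_fst hx he (Fin.ext h)
  unfold Encloses at *
  simp only [Fin.lt_def] at *
  constructor
  · rintro ⟨h1, h2⟩
    rcases h1.eq_or_lt with h | h
    · exact Or.inl (hne h.symm)
    · right; have := this h (by omega); omega
  · rintro (rfl | h)
    · exact ⟨le_rfl, hj⟩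
    · omega

/-- If `[e.1, j)` starts with an arc `e` to the left of `a`, the arcs around `(a, d)` over this
interval start to the right of `e`. -/
theorem lt_of_left {γ : CrossinglessMatching n} {a d : Fin (2 * n)} (had : a < d)
    {e x : Arc n} (he : e ∈ γ.arcs) (hea : e.2 < a) (hx : x ∈ γ.arcs)
    (hxa : Encloses x (a, d)) (h : (e.1 : ℕ) ≤ x.1) : (e.2 : ℕ) + 1 ≤ x.1 := by
  have h1 := @encloses_of_lt n γ x e hx he
  have h2 : (x.1 : ℕ) = e.1 → x = e := fun h => eq_of_fst hx he (Fin.ext h)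
  have h3 := fst_ne_snd hx he
  have h4 : x ≠ e := by rintro rfl; have := hxa.2; simp only [Fin.lt_def] at *; omega
  unfold Encloses at *
  simp only [Fin.lt_def, Ne, Fin.ext_iff] at *
  by_contra hcon
  have h5 : (e.1 : ℕ) < x.1 := lt_of_le_of_ne h fun h => h4 (h2 h.symm)
  have := h1 h5 (by omega)
  omega

theorem weight_insert (γ : CrossinglessMatching n) (D : Finset (Arc n)) (x : Arc n) {i j : ℕ}
    (h : (x.1 : ℕ) < i ∨ j ≤ x.2) : weight γ (insert x D) i j = weight γ D i j := by
  refine weight_congr fun f h1 h12 h2 => ⟨Iff.rfl, fun hf => ?_⟩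
  have hfx : f ≠ x := by rintro rfl; omega
  simp [hfx]

theorem T_mul_T_sub_T (r s : ℕ) : (LaurentPolynomial.T (r - s) : ℤ[T;T⁻¹]) *
    (LaurentPolynomial.T 1 - LaurentPolynomial.T (-1)) =
    (1 - LaurentPolynomial.T (-2)) * LaurentPolynomial.T (((r + 1 : ℕ) : ℤ) - s) := by
  rw [mul_sub, sub_mul, one_mul, ← LaurentPolynomial.T_add, ← LaurentPolynomial.T_add,
    ← LaurentPolynomial.T_add]
  congr 2 <;> push_cast <;> ring

open Finset in
set_option maxHeartbeats 1000000 in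
/-- Passing from the arcs over `a, …, d` to the surrounding arcs turns the central variable `X`
into the correction terms of the quantum Russell relations. -/
theorem Framed.eq_add_sum {γ : CrossinglessMatching n} {D : Finset (Arc n)} {a d : Fin (2 * n)}
    {V : ℕ → ℕ → WordAlgebra[X]} (hV : Framed γ D a d V) (had : a < d) (hD : D ⊆ γ.arcs)
    (hc : γ.Closes a (d + 1)) {c : ℤ[T;T⁻¹]}
    (h0 : V a (d + 1) = c • (X * weight γ D a (d + 1))) {i j : ℕ} (hi : i ≤ a) (hdj : (d : ℕ) < j)
    (hj : j ≤ 2 * n) (hij : γ.Closes i j) :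
    V i j = (c * LaurentPolynomial.T
        ((#{x ∈ undottedAround γ D a d | i ≤ (x.1 : ℕ) ∧ (x.2 : ℕ) < j} : ℤ)
          - #{x ∈ D | Encloses x (a, d) ∧ i ≤ (x.1 : ℕ) ∧ (x.2 : ℕ) < j})) • (X * weight γ D i j)
      + ∑ x ∈ undottedAround γ D a d with i ≤ (x.1 : ℕ) ∧ (x.2 : ℕ) < j,
        (c * ((1 - LaurentPolynomial.T (-2)) * LaurentPolynomial.T
          ((level γ D a d x : ℤ) - dottedBetween D a d x))) • weight γ (insert x D) i j := by
  have hmemU : ∀ x, x ∈ undottedAround γ D a d ↔ (x ∈ γ.arcs ∧ x ∉ D) ∧ Encloses x (a, d) := by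
    intro x; simp [undottedAround]
  -- If `i = a`, no surrounding arc lies over `[i, j)`.
  rcases hi.eq_or_lt with rfl | hi
  · have e1 : {x ∈ undottedAround γ D a d | (a : ℕ) ≤ (x.1 : ℕ) ∧ (x.2 : ℕ) < j} = ∅ := by
      refine filter_eq_empty_iff.2 fun x hx hcon => ?_
      have := ((hmemU x).1 hx).2.1
      simp only [Fin.lt_def] at *; omega
    have e2 : {x ∈ D | Encloses x (a, d) ∧ (a : ℕ) ≤ (x.1 : ℕ) ∧ (x.2 : ℕ) < j} = ∅ := by
      refine filter_eq_empty_iff.2 fun x hx hcon => ?_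
      have := hcon.1.1
      simp only [Fin.lt_def] at *; omega
    rw [e1, e2, hV.start j hdj, h0,
      weight_mul D hc (by simp only [Fin.lt_def] at *; omega) hdj (by omega)]
    simp [mul_assoc]
  obtain ⟨e, he, hei, hej⟩ := hij.exists_arc (by omega) hj
  have hlt := γ.fst_lt_snd _ he
  have hce := hc e he
  subst hei
  have hcase : e.2 < a ∨ d < e.2 := by simp only [Fin.lt_def] at *; omega
  rcases hcase with hea | hed
  -- The first arc `e` lies to the left of `a`: it contributes the same factor on both sides.
  · have hea' : (e.2 : ℕ) + 1 ≤ a := hea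
    have ih := Framed.eq_add_sum hV had hD hc h0 hea' hdj hj (hij.after he rfl)
    have hiff : ∀ x ∈ γ.arcs, Encloses x (a, d) →
        (((e.1 : ℕ) ≤ x.1 ∧ (x.2 : ℕ) < j) ↔ ((e.2 : ℕ) + 1 ≤ x.1 ∧ (x.2 : ℕ) < j)) := by
      intro x hx hxa
      have := lt_of_left had he hea hx hxa
      simp only [Fin.lt_def] at *
      omega
    have e1 : {x ∈ undottedAround γ D a d | (e.1 : ℕ) ≤ (x.1 : ℕ) ∧ (x.2 : ℕ) < j} =
        {x ∈ undottedAround γ D a d | (e.2 : ℕ) + 1 ≤ (x.1 : ℕ) ∧ (x.2 : ℕ) < j} :=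
      filter_congr fun x hx => hiff x ((hmemU x).1 hx).1.1 ((hmemU x).1 hx).2
    have e2 : {x ∈ D | Encloses x (a, d) ∧ (e.1 : ℕ) ≤ (x.1 : ℕ) ∧ (x.2 : ℕ) < j} =
        {x ∈ D | Encloses x (a, d) ∧ (e.2 : ℕ) + 1 ≤ (x.1 : ℕ) ∧ (x.2 : ℕ) < j} :=
      filter_congr fun x hx => and_congr_right fun hxa => hiff x (hD hx) hxa
    rw [hV.left e he j hea hdj, ih, e1, e2, mul_add, mul_smul_comm, mul_X_mul,
      ← weight_arc D he rfl hej, mul_sum]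
    congr 1
    refine sum_congr rfl fun x hx => ?_
    have hxlt : (e.2 : ℕ) + 1 ≤ x.1 := (mem_filter.1 hx).2.1
    rw [mul_smul_comm, weight_arc (insert x D) he rfl hej]
    have hex : e ≠ x := by rintro rfl; simp only [Fin.lt_def] at *; omega
    have hxx := γ.fst_lt_snd x ((hmemU x).1 (mem_filter.1 hx).1).1.1
    rw [weight_insert γ D x (i := e.1 + 1) (j := e.2)
      (Or.inr (by simp only [Fin.lt_def] at *; omega))]
    simp only [wrap, mem_insert, hex, false_or]
  -- The first arc `e` surrounds `a` and `d`: induct on the interval under `e`.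
  · have hea : Encloses e (a, d) := ⟨hi, hed⟩
    have hi' : (e.1 : ℕ) + 1 ≤ a := hi
    have ih := Framed.eq_add_sum hV had hD hc h0 hi' hed (by omega) (Closes.inside he)
    have hiff := fun x hx hxa => mem_between_iff (x := x) had he hea hx hxa hej
    -- The correction terms of the arcs inside `e` have the required form for `[e.1, j)`.
    have hsum : wrap D e (∑ x ∈ undottedAround γ D a d with
          (e.1 : ℕ) + 1 ≤ (x.1 : ℕ) ∧ (x.2 : ℕ) < e.2,
        (c * ((1 - LaurentPolynomial.T (-2)) * LaurentPolynomial.T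
          ((level γ D a d x : ℤ) - dottedBetween D a d x))) •
            weight γ (insert x D) (e.1 + 1) e.2) * weight γ D (e.2 + 1) j =
        ∑ x ∈ undottedAround γ D a d with (e.1 : ℕ) + 1 ≤ (x.1 : ℕ) ∧ (x.2 : ℕ) < e.2,
        (c * ((1 - LaurentPolynomial.T (-2)) * LaurentPolynomial.T
          ((level γ D a d x : ℤ) - dottedBetween D a d x))) • weight γ (insert x D) e.1 j := by
      rw [map_sum, sum_mul]
      refine sum_congr rfl fun x hx => ?_
      obtain ⟨hx0, hx1, hx2⟩ := mem_filter.1 hx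
      rw [map_smul, smul_mul_assoc, weight_arc (insert x D) he rfl hej]
      have hex : e ≠ x := by rintro rfl; omega
      have hxa := ((hmemU x).1 hx0).2.1
      rw [weight_insert γ D x (i := e.2 + 1) (Or.inl (by simp only [Fin.lt_def] at *; omega))]
      simp only [wrap, mem_insert, hex, false_or]
    rw [hV.around e he j hea hej, ih, map_add, add_mul, hsum, map_smul, smul_mul_assoc]
    by_cases heD : e ∈ D
    -- A dotted `e` multiplies the term with `X` by `q⁻¹`.
    · have e1 : {x ∈ undottedAround γ D a d | (e.1 : ℕ) ≤ (x.1 : ℕ) ∧ (x.2 : ℕ) < j} =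
          {x ∈ undottedAround γ D a d | (e.1 : ℕ) + 1 ≤ (x.1 : ℕ) ∧ (x.2 : ℕ) < e.2} := by
        refine filter_congr fun x hx => ?_
        have hx' := (hmemU x).1 hx
        have hne : x ≠ e := by rintro rfl; exact hx'.1.2 heD
        simpa [hne] using hiff x hx'.1.1 hx'.2
      have e2 : {x ∈ D | Encloses x (a, d) ∧ (e.1 : ℕ) ≤ (x.1 : ℕ) ∧ (x.2 : ℕ) < j} =
          insert e {x ∈ D | Encloses x (a, d) ∧ (e.1 : ℕ) + 1 ≤ (x.1 : ℕ) ∧ (x.2 : ℕ) < e.2} := by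
        ext x
        simp only [mem_filter, mem_insert]
        constructor
        · rintro ⟨hx, hxa, h⟩
          exact ((hiff x (hD hx) hxa).1 h).imp id fun h => ⟨hx, hxa, h⟩
        · rintro (rfl | ⟨hx, hxa, h⟩)
          · exact ⟨heD, hea, le_rfl, hej⟩
          · exact ⟨hx, hxa, (hiff x (hD hx) hxa).2 (Or.inr h)⟩
      rw [e1, e2, card_insert_of_notMem (by simp), weight_arc D he rfl hej]
      simp only [wrap, heD, if_true]
      rw [dottedWrap_X_mul, smul_mul_assoc, smul_smul, mul_assoc c, ← LaurentPolynomial.T_add,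
        mul_assoc X]
      congr 4
      push_cast; ring
    -- An undotted `e` multiplies the term with `X` by `q` and adds a correction term for `e`.
    · have e1 : {x ∈ undottedAround γ D a d | (e.1 : ℕ) ≤ (x.1 : ℕ) ∧ (x.2 : ℕ) < j} = insert e
          {x ∈ undottedAround γ D a d | (e.1 : ℕ) + 1 ≤ (x.1 : ℕ) ∧ (x.2 : ℕ) < e.2} := by
        ext x
        simp only [mem_filter, mem_insert]
        constructor
        · rintro ⟨hx, h⟩
          have hx' := (hmemU x).1 hx
          exact ((hiff x hx'.1.1 hx'.2).1 h).imp id fun h => ⟨hx, h⟩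
        · rintro (rfl | ⟨hx, h⟩)
          · exact ⟨(hmemU x).2 ⟨⟨he, heD⟩, hea⟩, le_rfl, hej⟩
          · have hx' := (hmemU x).1 hx
            exact ⟨hx, (hiff x hx'.1.1 hx'.2).2 (Or.inr h)⟩
      have e2 : {x ∈ D | Encloses x (a, d) ∧ (e.1 : ℕ) ≤ (x.1 : ℕ) ∧ (x.2 : ℕ) < j} =
          {x ∈ D | Encloses x (a, d) ∧ (e.1 : ℕ) + 1 ≤ (x.1 : ℕ) ∧ (x.2 : ℕ) < e.2} := by
        refine filter_congr fun x hx => and_congr_right fun hxa => ?_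
        have hne : x ≠ e := by rintro rfl; exact heD hx
        simpa [hne] using hiff x (hD hx) hxa
      have hlev : level γ D a d e =
          #{x ∈ undottedAround γ D a d | (e.1 : ℕ) + 1 ≤ (x.1 : ℕ) ∧ (x.2 : ℕ) < e.2} + 1 := by
        rw [level, ← card_insert_of_notMem (a := e) (by simp)]
        congr 1
        ext x
        simp only [mem_filter, mem_insert, Encloses, Fin.lt_def, Nat.succ_le_iff]
        constructor
        · rintro ⟨hx, h | h⟩
          · exact Or.inl h
          · exact Or.inr ⟨hx, h⟩
        · rintro (rfl | ⟨hx, h⟩)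
          · exact ⟨(hmemU x).2 ⟨⟨he, heD⟩, hea⟩, Or.inl rfl⟩
          · exact ⟨hx, Or.inr h⟩
      have hbet : dottedBetween D a d e =
          #{x ∈ D | Encloses x (a, d) ∧ (e.1 : ℕ) + 1 ≤ (x.1 : ℕ) ∧ (x.2 : ℕ) < e.2} := by
        rw [dottedBetween]
        congr 1
        ext x
        simp only [mem_filter, Encloses, Fin.lt_def, Nat.succ_le_iff]
        tauto
      have hwe : weight γ (insert e D) e.1 j =
          dottedWrap (weight γ D (e.1 + 1) e.2) * weight γ D (e.2 + 1) j := by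
        rw [weight_arc (insert e D) he rfl hej]
        simp only [wrap, mem_insert, true_or, if_true]
        rw [weight_insert γ D e (Or.inl (Nat.lt_succ_self _)), weight_insert γ D e (Or.inl ?_)]
        exact Nat.lt_succ_of_lt hlt
      rw [e1, e2, sum_insert (by simp), card_insert_of_notMem (by simp), hlev, hbet, hwe,
        weight_arc D he rfl hej]
      simp only [wrap, heD, if_false]
      generalize #{x ∈ undottedAround γ D a d | (e.1 : ℕ) + 1 ≤ (x.1 : ℕ) ∧ (x.2 : ℕ) < e.2} = r
      generalize #{x ∈ D | Encloses x (a, d) ∧ (e.1 : ℕ) + 1 ≤ (x.1 : ℕ) ∧ (x.2 : ℕ) < e.2} = s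
      rw [plainWrap_X_mul, add_mul, smul_mul_assoc, smul_mul_assoc, mul_assoc X, smul_add,
        smul_smul, smul_smul, add_assoc]
      congr 2
      · rw [mul_assoc, ← LaurentPolynomial.T_add]
        congr 2; push_cast; ring
      · rw [mul_assoc, T_mul_T_sub_T]
termination_by j - i
end QuantumRussell

/-! ### The invariant vanishes on the relations -/

namespace QuantumRussell
open Polynomial
open CrossinglessMatching

variable {n : ℕ}

namespace IsSurgery

variable {α β : CrossinglessMatching n} {a b c d : Fin (2 * n)}

theorem mem_iff (h : IsSurgery α β a b c d) (e : Arc n) :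
    (e ∈ α.arcs ∧ e ≠ (a, b) ∧ e ≠ (c, d)) ↔ (e ∈ β.arcs ∧ e ≠ (a, d) ∧ e ≠ (b, c)) := by
  simpa using Finset.ext_iff.1 h.rest_eq e

theorem mem_iff_of_inside (h : IsSurgery α β a b c d) {e : Arc n}
    (he : (a < e.1 ∧ e.1 < b) ∨ (b < e.1 ∧ e.1 < c) ∨ (c < e.1 ∧ e.1 < d)) :
    e ∈ α.arcs ↔ e ∈ β.arcs := by
  have h1 := h.a_lt_b
  have h2 := h.b_lt_c
  have := h.mem_iff e
  have n1 : e ≠ (a, b) := by rintro rfl; simp only [Fin.lt_def] at *; omega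
  have n2 : e ≠ (c, d) := by rintro rfl; simp only [Fin.lt_def] at *; omega
  have n3 : e ≠ (a, d) := by rintro rfl; simp only [Fin.lt_def] at *; omega
  have n4 : e ≠ (b, c) := by rintro rfl; simp only [Fin.lt_def] at *; omega
  tauto

theorem mem_iff_of_outside (h : IsSurgery α β a b c d) {e : Arc n} (he : e.1 < a ∨ d < e.1) :
    e ∈ α.arcs ↔ e ∈ β.arcs := by
  have h1 := h.a_lt_b
  have h2 := h.b_lt_c
  have h3 := h.c_lt_d
  have := h.mem_iff e
  have n1 : e ≠ (a, b) := by rintro rfl; simp only [Fin.lt_def] at *; omega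
  have n2 : e ≠ (c, d) := by rintro rfl; simp only [Fin.lt_def] at *; omega
  have n3 : e ≠ (a, d) := by rintro rfl; simp only [Fin.lt_def] at *; omega
  have n4 : e ≠ (b, c) := by rintro rfl; simp only [Fin.lt_def] at *; omega
  tauto

theorem closes_left (h : IsSurgery α β a b c d) : α.Closes a (d + 1) := by
  intro e he
  have h1 := h.a_lt_b
  have h2 := h.b_lt_c
  have h3 := h.c_lt_d
  by_cases n1 : e = (a, b)
  · subst n1; simp only [Fin.lt_def] at *; omega
  by_cases n2 : e = (c, d)
  · subst n2; simp only [Fin.lt_def] at *; omega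
  exact Closes.arc h.ad_mem e ((h.mem_iff e).1 ⟨he, n1, n2⟩).1

theorem closes_middle (h : IsSurgery α β a b c d) : α.Closes (b + 1) c := by
  intro e he
  have h1 := h.a_lt_b
  have h2 := h.b_lt_c
  have h3 := h.c_lt_d
  by_cases n1 : e = (a, b)
  · subst n1; simp only [Fin.lt_def] at *; omega
  by_cases n2 : e = (c, d)
  · subst n2; simp only [Fin.lt_def] at *; omega
  exact Closes.inside h.bc_mem e ((h.mem_iff e).1 ⟨he, n1, n2⟩).1

theorem closes_inner (h : IsSurgery α β a b c d) : β.Closes (a + 1) b := by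
  intro e he
  have h1 := h.a_lt_b
  have h2 := h.b_lt_c
  have h3 := h.c_lt_d
  by_cases n1 : e = (a, d)
  · subst n1; simp only [Fin.lt_def] at *; omega
  by_cases n2 : e = (b, c)
  · subst n2; simp only [Fin.lt_def] at *; omega
  exact Closes.inside h.ab_mem e ((h.mem_iff e).2 ⟨he, n1, n2⟩).1

theorem weight_left (h : IsSurgery α β a b c d) (S : Finset (Arc n)) :
    weight α S a (d + 1) = wrap S (a, b) (weight α S (a + 1) b) * weight α S (b + 1) c
      * wrap S (c, d) (weight α S (c + 1) d) := by
  have h1 := h.a_lt_b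
  have h2 := h.b_lt_c
  have h3 := h.c_lt_d
  simp only [Fin.lt_def] at *
  rw [weight_arc S h.ab_mem rfl (by simp only; omega),
    weight_mul S h.closes_middle h2 (by omega) (by omega),
    weight_arc S h.cd_mem rfl (by simp only; omega), weight_of_le α S le_rfl, mul_one, mul_assoc]

theorem weight_right (h : IsSurgery α β a b c d) (S : Finset (Arc n)) :
    weight β S a (d + 1) = wrap S (a, d) (weight β S (a + 1) b
      * wrap S (b, c) (weight β S (b + 1) c) * weight β S (c + 1) d) := by
  have h1 := h.a_lt_b
  have h2 := h.b_lt_c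
  have h3 := h.c_lt_d
  simp only [Fin.lt_def] at *
  rw [weight_arc S h.ad_mem rfl (by simp only; omega), weight_of_le β S le_rfl, mul_one,
    weight_mul S h.closes_inner h1 (h2.trans h3).le b.isLt.le,
    weight_arc S h.bc_mem rfl (by simp only; omega), mul_assoc]

/-- The value of the left side of the surgery in terms of the values of the three diagrams between
the four points. -/
theorem weight_left_eq (h : IsSurgery α β a b c d) {S D : Finset (Arc n)}
    (hS : ∀ e ∈ α.arcs, e ≠ (a, b) → e ≠ (c, d) → (e ∈ S ↔ e ∈ D)) :
    weight α S a (d + 1) = wrap S (a, b) (weight α D (a + 1) b) * weight α D (b + 1) c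
      * wrap S (c, d) (weight α D (c + 1) d) := by
  have h1 := h.a_lt_b
  have h2 := h.b_lt_c
  have h3 := h.c_lt_d
  have key : ∀ i j : ℕ, (a : ℕ) < i → (c : ℕ) < i ∨ j ≤ c → weight α S i j = weight α D i j := by
    intro i j hi hj
    refine weight_congr fun e e1 e12 e2 => ⟨Iff.rfl, fun he => hS e he ?_ ?_⟩ <;>
    · rintro rfl; simp only [Fin.lt_def] at *; omega
  simp only [Fin.lt_def] at *
  rw [h.weight_left, key (a + 1) b (by omega) (by omega), key (b + 1) c (by omega) (by omega),
    key (c + 1) d (by omega) (by omega)]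

/-- The value of the right side of the surgery in terms of the values of the three diagrams between
the four points. -/
theorem weight_right_eq (h : IsSurgery α β a b c d) {S D : Finset (Arc n)}
    (hS : ∀ e ∈ β.arcs, e ≠ (a, d) → e ≠ (b, c) → (e ∈ S ↔ e ∈ D)) :
    weight β S a (d + 1) = wrap S (a, d) (weight α D (a + 1) b
      * wrap S (b, c) (weight α D (b + 1) c) * weight α D (c + 1) d) := by
  have h1 := h.a_lt_b
  have h2 := h.b_lt_c
  have h3 := h.c_lt_d
  have key : ∀ i j : ℕ, ((a : ℕ) + 1 = i ∧ j = b) ∨ ((b : ℕ) + 1 = i ∧ j = c) ∨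
      ((c : ℕ) + 1 = i ∧ j = d) → weight β S i j = weight α D i j := by
    intro i j hij
    refine weight_congr fun e e1 e12 e2 =>
      ⟨(h.mem_iff_of_inside ?_).symm, fun he => hS e he ?_ ?_⟩
    · simp only [Fin.lt_def] at *; omega
    · rintro rfl; simp only [Fin.lt_def] at *; omega
    · rintro rfl; simp only [Fin.lt_def] at *; omega
  simp only [Fin.lt_def] at *
  rw [h.weight_right, key (a + 1) b (by omega), key (b + 1) c (by omega), key (c + 1) d (by omega)]

end IsSurgery

/-- The constant term with respect to the central variable `X`. -/
noncomputable def constTerm : WordAlgebra[X] →ₗ[ℤ[T;T⁻¹]] WordAlgebra :=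
  (Polynomial.lcoeff WordAlgebra 0).restrictScalars _

theorem constTerm_apply (f : WordAlgebra[X]) : constTerm f = f.coeff 0 := rfl

theorem constTerm_X_mul (f : WordAlgebra[X]) : constTerm (X * f) = 0 := by
  simp [constTerm_apply]

/-- The linear map that sends a dotted matching to the constant term of its weight. It vanishes
on the quantum Russell relations. -/
noncomputable def eval (n k : ℕ) : FreeSpace n k →ₗ[ℤ[T;T⁻¹]] WordAlgebra :=
  Finsupp.linearCombination _ fun m : DottedMatching n k =>
    constTerm (weight m.toCrossinglessMatching m.dots 0 (2 * n))

theorem eval_single {k : ℕ} (m : DottedMatching n k) :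
    eval n k (Finsupp.single m 1) =
      constTerm (weight m.toCrossinglessMatching m.dots 0 (2 * n)) := by
  simp [eval]

theorem eval_diagram {k : ℕ} {α : CrossinglessMatching n} {S : Finset (Arc n)} (h : S ⊆ α.arcs)
    (hk : S.card = k) : eval n k (diagram k α S) = constTerm (weight α S 0 (2 * n)) := by
  rw [diagram, dif_pos ⟨h, hk⟩, eval_single]

theorem filter_eq_self_of_univ (s : Finset (Arc n)) :
    {x ∈ s | 0 ≤ (x.1 : ℕ) ∧ (x.2 : ℕ) < 2 * n} = s :=
  Finset.filter_true_of_mem fun x _ => ⟨Nat.zero_le _, x.2.isLt⟩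

theorem eval_typeI {k : ℕ} {α β : CrossinglessMatching n} {a b c d : Fin (2 * n)}
    {D : Finset (Arc n)} (h : IsSurgery α β a b c d) (hD : D ⊆ α.arcs \ {(a, b), (c, d)})
    (hk : D.card + 1 = k) : eval n k (typeI k α β a b c d D) = 0 := by
  have hab := h.a_lt_b
  have hbc := h.b_lt_c
  have hcd := h.c_lt_d
  have had : a < d := hab.trans (hbc.trans hcd)
  have hDα : ∀ e ∈ D, e ∈ α.arcs ∧ e ≠ (a, b) ∧ e ≠ (c, d) := fun e he => by
    simpa using hD he
  have hDβ : ∀ e ∈ D, e ∈ β.arcs ∧ e ≠ (a, d) ∧ e ≠ (b, c) := fun e he =>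
    (h.mem_iff e).1 (hDα e he)
  have nab : (a, b) ∉ D := fun hx => (hDα _ hx).2.1 rfl
  have ncd : (c, d) ∉ D := fun hx => (hDα _ hx).2.2 rfl
  have nad : (a, d) ∉ D := fun hx => (hDβ _ hx).2.1 rfl
  have nbc : (b, c) ∉ D := fun hx => (hDβ _ hx).2.2 rfl
  have hcard : ∀ x ∉ D, (insert x D).card = k := fun x hx => by
    rw [Finset.card_insert_of_notMem hx, hk]
  have hα : ∀ x ∈ α.arcs, insert x D ⊆ α.arcs := fun x hx =>
    Finset.insert_subset hx fun e he => (hDα e he).1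
  have hβ : ∀ x ∈ β.arcs, insert x D ⊆ β.arcs := fun x hx =>
    Finset.insert_subset hx fun e he => (hDβ e he).1
  have fα : ∀ x : Arc n, a ≤ x.1 → x.1 ≤ d → Framed α D a d (weight α (insert x D)) := by
    intro x hx1 hx2
    refine Framed.of_weight had h.closes_left fun e he => ⟨Iff.rfl, fun _ => ?_⟩
    have : e ≠ x := by rintro rfl; simp only [Fin.lt_def, Fin.le_def] at *; omega
    simp [this]
  have fβ : ∀ x : Arc n, a ≤ x.1 → x.1 ≤ d → Framed α D a d (weight β (insert x D)) := by
    intro x hx1 hx2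
    refine Framed.of_weight had (Closes.arc h.ad_mem) fun e he =>
      ⟨(h.mem_iff_of_outside he).symm, fun _ => ?_⟩
    have : e ≠ x := by rintro rfl; simp only [Fin.lt_def, Fin.le_def] at *; omega
    simp [this]
  have hV := (((fβ (b, c) hab.le (hbc.trans hcd).le).sub (fα (a, b) le_rfl had.le)).sub
    (fα (c, d) (hab.trans hbc).le hcd.le)).sub
    ((fβ (a, d) le_rfl had.le).smul (LaurentPolynomial.T (-1)))
  have key := hV.eq_add_sum had (fun e he => (hDα e he).1) h.closes_left (c := 1)
    (by
      rw [h.weight_right_eq (S := insert (b, c) D) (D := D) (by simp +contextual),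
        h.weight_left_eq (S := insert (a, b) D) (D := D) (by simp +contextual),
        h.weight_left_eq (S := insert (c, d) D) (D := D) (by simp +contextual),
        h.weight_right_eq (S := insert (a, d) D) (D := D) (by simp +contextual),
        h.weight_left_eq (S := D) (D := D) (by simp)]
      have e1 : (a, d) ≠ (b, c) := by simp [hab.ne]
      have e2 : (c, d) ≠ (a, b) := by simp [(hab.trans hbc).ne']
      simp only [wrap, Finset.mem_insert, nab, ncd, nad, nbc, e1, e2, e1.symm, e2.symm,
        or_false, if_true, if_false]
      rw [plainWrap_mul_dottedWrap_mul, one_smul]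
      abel)
    (Nat.zero_le _) d.isLt le_rfl (closes_univ α)
  simp only [filter_eq_self_of_univ] at key
  have key' := congrArg constTerm key
  simp only [map_sub, map_add, map_smul, map_sum, constTerm_X_mul, smul_zero, zero_add,
    one_mul] at key'
  rw [typeI, map_sub, map_add, map_add, map_add, map_smul, map_sum,
    eval_diagram (hβ _ h.bc_mem) (hcard _ nbc), eval_diagram (hα _ h.ab_mem) (hcard _ nab),
    eval_diagram (hα _ h.cd_mem) (hcard _ ncd), eval_diagram (hβ _ h.ad_mem) (hcard _ nad)]
  rw [Finset.sum_congr rfl fun x hx => ?_, ← key']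
  · abel
  · have hx' : (x ∈ α.arcs ∧ x ∉ D) ∧ Encloses x (a, d) := by simpa [undottedAround] using hx
    rw [map_smul, eval_diagram (hα _ hx'.1.1) (hcard _ hx'.1.2)]

theorem eval_typeII {k : ℕ} {α β : CrossinglessMatching n} {a b c d : Fin (2 * n)}
    {D : Finset (Arc n)} (h : IsSurgery α β a b c d) (hD : D ⊆ α.arcs \ {(a, b), (c, d)})
    (hk : D.card + 2 = k) : eval n k (typeII k α β a b c d D) = 0 := by
  have hab := h.a_lt_b
  have hbc := h.b_lt_c
  have hcd := h.c_lt_d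
  have had : a < d := hab.trans (hbc.trans hcd)
  have hDα : ∀ e ∈ D, e ∈ α.arcs ∧ e ≠ (a, b) ∧ e ≠ (c, d) := fun e he => by
    simpa using hD he
  have hDβ : ∀ e ∈ D, e ∈ β.arcs ∧ e ≠ (a, d) ∧ e ≠ (b, c) := fun e he =>
    (h.mem_iff e).1 (hDα e he)
  have nab : (a, b) ∉ D := fun hx => (hDα _ hx).2.1 rfl
  have ncd : (c, d) ∉ D := fun hx => (hDα _ hx).2.2 rfl
  have nad : (a, d) ∉ D := fun hx => (hDβ _ hx).2.1 rfl
  have nbc : (b, c) ∉ D := fun hx => (hDβ _ hx).2.2 rfl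
  have e1 : (a, d) ≠ (b, c) := by simp [hab.ne]
  have e2 : (a, b) ≠ (c, d) := by simp [(hab.trans hbc).ne]
  have hcard : ∀ x y, x ≠ y → x ∉ D → y ∉ D → (insert x (insert y D)).card = k :=
    fun x y hxy hx hy => by
      rw [Finset.card_insert_of_notMem (by simp [hxy, hx]), Finset.card_insert_of_notMem hy, ← hk]
  have hα : ∀ x ∈ α.arcs, ∀ y ∈ α.arcs, insert x (insert y D) ⊆ α.arcs := fun x hx y hy =>
    Finset.insert_subset hx (Finset.insert_subset hy fun e he => (hDα e he).1)
  have hβ : ∀ x ∈ β.arcs, ∀ y ∈ β.arcs, insert x (insert y D) ⊆ β.arcs := fun x hx y hy =>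
    Finset.insert_subset hx (Finset.insert_subset hy fun e he => (hDβ e he).1)
  have fα : Framed β (insert (a, d) D) a d (weight α (insert (a, b) (insert (c, d) D))) := by
    refine Framed.of_weight had h.closes_left fun e he => ⟨h.mem_iff_of_outside he, fun _ => ?_⟩
    have n1 : e ≠ (a, b) := by rintro rfl; simp only [Fin.lt_def] at *; omega
    have n2 : e ≠ (c, d) := by rintro rfl; simp only [Fin.lt_def] at *; omega
    have n3 : e ≠ (a, d) := by rintro rfl; simp only [Fin.lt_def] at *; omega
    simp [n1, n2, n3]
  have fβ : Framed β (insert (a, d) D) a d (weight β (insert (a, d) (insert (b, c) D))) := by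
    refine Framed.of_weight had (Closes.arc h.ad_mem) fun e he => ⟨Iff.rfl, fun _ => ?_⟩
    have n1 : e ≠ (b, c) := by rintro rfl; simp only [Fin.lt_def] at *; omega
    simp [n1]
  have key := (fα.sub fβ).eq_add_sum had
    (Finset.insert_subset h.ad_mem fun e he => (hDβ e he).1) (Closes.arc h.ad_mem)
    (c := LaurentPolynomial.T (-1))
    (by
      rw [h.weight_left_eq (S := insert (a, b) (insert (c, d) D)) (D := D) (by simp +contextual),
        h.weight_right_eq (S := insert (a, d) (insert (b, c) D)) (D := D) (by simp +contextual),
        h.weight_right_eq (S := insert (a, d) D) (D := D) (by simp +contextual)]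
      simp only [wrap, Finset.mem_insert, nab, ncd, nad, nbc, e1, e2, e1.symm, e2.symm,
        or_false, or_true, if_true, if_false]
      rw [dottedWrap_mul_mul_dottedWrap]
      abel)
    (Nat.zero_le _) d.isLt le_rfl (closes_univ β)
  have hne : ∀ x : Arc n, Encloses x (a, d) → x ≠ (a, d) := by
    rintro x hx rfl; exact lt_irrefl _ hx.1
  have hU : undottedAround β (insert (a, d) D) a d = undottedAround α D a d := by
    ext x
    simp only [undottedAround, Finset.mem_filter, Finset.mem_sdiff, Finset.mem_insert, not_or]
    refine and_congr_left fun hx => ?_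
    have := h.mem_iff_of_outside (e := x) (Or.inl hx.1)
    have := hne x hx
    tauto
  have hL : ∀ x, level β (insert (a, d) D) a d x = level α D a d x := fun x => by
    rw [level, level, hU]
  have hB : ∀ x, dottedBetween (insert (a, d) D) a d x = dottedBetween D a d x := fun x => by
    rw [dottedBetween, dottedBetween, Finset.filter_insert, if_neg]
    rintro ⟨-, hx⟩
    exact hne _ hx rfl
  simp only [filter_eq_self_of_univ, hU, hL, hB] at key
  have key' := congrArg constTerm key
  simp only [map_sub, map_add, map_smul, map_sum, constTerm_X_mul, smul_zero, zero_add] at key'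
  rw [typeII, map_sub, map_add, map_sum,
    eval_diagram (hα _ h.ab_mem _ h.cd_mem) (hcard _ _ e2 nab ncd),
    eval_diagram (hβ _ h.ad_mem _ h.bc_mem) (hcard _ _ e1 nad nbc),
    sub_add_eq_sub_sub, key', sub_eq_zero]
  refine Finset.sum_congr rfl fun x hx => ?_
  have hx' : (x ∈ α.arcs ∧ x ∉ D) ∧ Encloses x (a, d) := by simpa [undottedAround] using hx
  rw [map_smul, eval_diagram (hβ _ h.ad_mem _ ((h.mem_iff_of_outside (Or.inl hx'.2.1)).1 hx'.1.1))
    (hcard _ _ (hne x hx'.2).symm nad hx'.1.2), Finset.insert_comm, mul_left_comm,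
    ← LaurentPolynomial.T_add]
  congr 3
  ring

theorem eval_eq_zero {k : ℕ} {r : FreeSpace n k} (hr : r ∈ relations n k) : eval n k r = 0 := by
  have : relations n k ≤ LinearMap.ker (eval n k) := by
    refine Submodule.span_le.2 ?_
    rintro r (⟨α, β, a, b, c, d, D, hs, hD, hk⟩ | ⟨α, β, a, b, c, d, D, hs, hD, hk⟩)
    · exact eval_typeI hs hD hk
    · exact eval_typeII hs hD hk
  exact this hr
end QuantumRussell

/-! ### Diagrams with dots on outer arcs span -/

namespace QuantumRussell
open CrossinglessMatching

variable {n : ℕ}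

/-- Arcs `(a, d)` and `(b, c)` of `β`, the second immediately inside the first, can be replaced by
`(a, b)` and `(c, d)`. -/
theorem exists_isSurgery {β : CrossinglessMatching n} {a b c d : Fin (2 * n)}
    (had : (a, d) ∈ β.arcs) (hbc : (b, c) ∈ β.arcs) (hab : a < b) (hcd : c < d)
    (hmin : ∀ f ∈ β.arcs, Encloses (a, d) f → ¬ Encloses f (b, c)) :
    ∃ α : CrossinglessMatching n, IsSurgery α β a b c d := by
  have hbc' : b < c := β.fst_lt_snd _ hbc
  let A : Finset (Arc n) := insert (a, b) (insert (c, d) (β.arcs \ {(a, d), (b, c)}))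
  have hA : ∀ e, e ∈ A ↔ e = (a, b) ∨ e = (c, d) ∨ (e ∈ β.arcs ∧ e ≠ (a, d) ∧ e ≠ (b, c)) := by
    intro e; simp [A]
  have hdis : ∀ e ∈ β.arcs, e ≠ (a, d) → e ≠ (b, c) → e.1 < e.2 ∧
      (e.1 ≠ a ∧ e.1 ≠ b ∧ e.1 ≠ c ∧ e.1 ≠ d) ∧ (e.2 ≠ a ∧ e.2 ≠ b ∧ e.2 ≠ c ∧ e.2 ≠ d) := by
    intro e he n1 n2
    refine ⟨β.fst_lt_snd _ he, ⟨?_, ?_, ?_, ?_⟩, ?_, ?_, ?_, ?_⟩ <;> intro h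
    · exact n1 (eq_of_endpoint he had (Or.inl rfl) (Or.inl h))
    · exact n2 (eq_of_endpoint he hbc (Or.inl rfl) (Or.inl h))
    · exact n2 (eq_of_endpoint he hbc (Or.inl rfl) (Or.inr h))
    · exact n1 (eq_of_endpoint he had (Or.inl rfl) (Or.inr h))
    · exact n1 (eq_of_endpoint he had (Or.inr rfl) (Or.inl h))
    · exact n2 (eq_of_endpoint he hbc (Or.inr rfl) (Or.inl h))
    · exact n2 (eq_of_endpoint he hbc (Or.inr rfl) (Or.inr h))
    · exact n1 (eq_of_endpoint he had (Or.inr rfl) (Or.inr h))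
  have hcross : ∀ e ∈ β.arcs, e ≠ (a, d) → e ≠ (b, c) →
      ¬ (e.1 < a ∧ a < e.2 ∧ e.2 < b) ∧ ¬ (a < e.1 ∧ e.1 < b ∧ b < e.2) ∧
      ¬ (e.1 < c ∧ c < e.2 ∧ e.2 < d) ∧ ¬ (c < e.1 ∧ e.1 < d ∧ d < e.2) := by
    intro e he n1 n2
    have h0 := hdis e he n1 n2
    have h1 := hmin e he
    have h2 := β.not_cross e he _ had
    have h3 := β.not_cross _ had e he
    have h4 := β.not_cross e he _ hbc
    have h5 := β.not_cross _ hbc e he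
    unfold Encloses at h1
    simp only [Fin.lt_def, Ne, Fin.ext_iff] at *
    omega
  refine ⟨⟨A, ?_, ?_, ?_⟩, hab, hbc', hcd, (hA _).2 (Or.inl rfl), (hA _).2 (Or.inr (Or.inl rfl)),
    had, hbc, ?_⟩
  · intro e he
    rcases (hA e).1 he with rfl | rfl | ⟨he, -⟩
    exacts [hab, hcd, β.fst_lt_snd _ he]
  · intro p
    by_cases hp1 : p = a ∨ p = b
    · refine ⟨(a, b), ⟨(hA _).2 (Or.inl rfl), hp1⟩, ?_⟩
      rintro e ⟨he, hpe⟩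
      rcases (hA e).1 he with rfl | rfl | ⟨he, n1, n2⟩
      · rfl
      · simp only [Fin.lt_def, Fin.ext_iff] at *; omega
      · have := hdis e he n1 n2
        simp only [Fin.lt_def, Ne, Fin.ext_iff] at *; omega
    by_cases hp2 : p = c ∨ p = d
    · refine ⟨(c, d), ⟨(hA _).2 (Or.inr (Or.inl rfl)), hp2⟩, ?_⟩
      rintro e ⟨he, hpe⟩
      rcases (hA e).1 he with rfl | rfl | ⟨he, n1, n2⟩
      · exact absurd hpe hp1
      · rfl
      · have := hdis e he n1 n2
        simp only [Fin.lt_def, Ne, Fin.ext_iff] at *; omega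
    obtain ⟨e, he, hpe⟩ := β.exists_arc p
    have n1 : e ≠ (a, d) := by rintro rfl; tauto
    have n2 : e ≠ (b, c) := by rintro rfl; tauto
    refine ⟨e, ⟨(hA _).2 (Or.inr (Or.inr ⟨he, n1, n2⟩)), hpe⟩, ?_⟩
    rintro f ⟨hf, hpf⟩
    rcases (hA f).1 hf with rfl | rfl | ⟨hf, -⟩
    · exact absurd hpf hp1
    · exact absurd hpf hp2
    · exact eq_of_endpoint hf he hpf hpe
  · intro e he f hf
    rcases (hA e).1 he with rfl | rfl | ⟨he, n1, n2⟩ <;>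
    rcases (hA f).1 hf with rfl | rfl | ⟨hf, m1, m2⟩
    · simp
    · simp only [Fin.lt_def] at *; omega
    · exact (hcross f hf m1 m2).2.1
    · simp only [Fin.lt_def] at *; omega
    · simp
    · exact (hcross f hf m1 m2).2.2.2
    · exact (hcross e he n1 n2).1
    · exact (hcross e he n1 n2).2.2.1
    · exact β.not_cross e he f hf
  · ext e
    simp only [Finset.mem_sdiff, hA, Finset.mem_insert, Finset.mem_singleton, not_or]
    constructor
    · rintro ⟨rfl | rfl | h, n1, n2⟩
      · exact absurd rfl n1
      · exact absurd rfl n2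
      · exact h
    · rintro ⟨he, n1, n2⟩
      have h0 := hdis e he n1 n2
      refine ⟨Or.inr (Or.inr ⟨he, n1, n2⟩), ?_, ?_⟩
      · rintro rfl; exact h0.2.1.1 rfl
      · rintro rfl; exact h0.2.1.2.2.1 rfl

/-- The number of arcs of `α` in which the arc `e` is nested. -/
def depth (α : CrossinglessMatching n) (e : Arc n) : ℕ := (α.arcs.filter fun f => Encloses f e).card

theorem depth_lt_depth {α : CrossinglessMatching n} {x e : Arc n} (hx : x ∈ α.arcs)
    (h : Encloses x e) : depth α x < depth α e := by
  refine Finset.card_lt_card (Finset.ssubset_iff_of_subset ?_ |>.2 ⟨x, ?_, ?_⟩)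
  · intro f hf
    obtain ⟨hf, hfx⟩ := Finset.mem_filter.1 hf
    exact Finset.mem_filter.2 ⟨hf, hfx.1.trans h.1, h.2.trans hfx.2⟩
  · exact Finset.mem_filter.2 ⟨hx, h⟩
  · intro hxx
    exact lt_irrefl _ (Finset.mem_filter.1 hxx).2.1

namespace IsSurgery

variable {α β : CrossinglessMatching n} {a b c d : Fin (2 * n)}

theorem depth_ab_le (h : IsSurgery α β a b c d) : depth α (a, b) ≤ depth β (a, d) := by
  refine Finset.card_le_card fun f hf => ?_
  obtain ⟨hf, hfe⟩ := Finset.mem_filter.1 hf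
  have hfβ := (h.mem_iff_of_outside (Or.inl hfe.1)).1 hf
  refine Finset.mem_filter.2 ⟨hfβ, encloses_of_endpoint h.ad_mem hfβ (Or.inl rfl) hfe.1 ?_⟩
  exact h.a_lt_b.trans hfe.2

theorem depth_cd_le (h : IsSurgery α β a b c d) : depth α (c, d) ≤ depth β (a, d) := by
  refine Finset.card_le_card fun f hf => ?_
  obtain ⟨hf, hfe⟩ := Finset.mem_filter.1 hf
  have hne : f ≠ (a, b) := by
    rintro rfl
    exact absurd hfe.2 (h.b_lt_c.trans h.c_lt_d).le.not_gt
  have hne' : f ≠ (c, d) := by rintro rfl; exact lt_irrefl _ hfe.1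
  have hfβ := ((h.mem_iff f).1 ⟨hf, hne, hne'⟩).1
  refine Finset.mem_filter.2 ⟨hfβ, encloses_of_endpoint h.ad_mem hfβ (Or.inr rfl) ?_ hfe.2⟩
  exact hfe.1.trans h.c_lt_d

theorem depth_le (h : IsSurgery α β a b c d) {e : Arc n} (he : e ∈ α.arcs) :
    depth α e ≤ depth β e := by
  have hab := h.a_lt_b
  have hbc := h.b_lt_c
  have hcd := h.c_lt_d
  -- Arcs of `α` around `e` are arcs of `β` around `e`, after `(a, b)`, `(c, d)` become `(a, d)`.
  refine Finset.card_le_card_of_injOn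
    (fun f => if f = (a, b) ∨ f = (c, d) then (a, d) else f) ?_ ?_
  · intro f hf
    obtain ⟨hf, hfe⟩ := Finset.mem_filter.1 hf
    refine Finset.mem_filter.2 ?_
    by_cases hfs : f = (a, b) ∨ f = (c, d)
    · simp only [hfs, if_true]
      refine ⟨h.ad_mem, ?_⟩
      unfold Encloses at *
      rcases hfs with rfl | rfl <;> simp only [Fin.lt_def] at * <;> omega
    · simp only [hfs, if_false]
      rw [not_or] at hfs
      exact ⟨((h.mem_iff f).1 ⟨hf, hfs.1, hfs.2⟩).1, hfe⟩
  · intro f hf g hg hfg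
    obtain ⟨hf, hfe⟩ := Finset.mem_filter.1 hf
    obtain ⟨hg, hge⟩ := Finset.mem_filter.1 hg
    have hnot : ¬ (Encloses (a, b) e ∧ Encloses (c, d) e) := by
      rintro ⟨⟨-, k1⟩, ⟨k2, -⟩⟩
      have := α.fst_lt_snd e he
      simp only [Fin.lt_def] at *; omega
    have hadα : (a, d) ∉ α.arcs := fun hm => by
      have := eq_of_fst hm h.ab_mem rfl
      exact absurd (Prod.ext_iff.1 this).2 (hbc.trans hcd).ne'
    by_cases hfs : f = (a, b) ∨ f = (c, d) <;> by_cases hgs : g = (a, b) ∨ g = (c, d)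
    · rcases hfs with rfl | rfl <;> rcases hgs with rfl | rfl
      · rfl
      · exact absurd ⟨hfe, hge⟩ hnot
      · exact absurd ⟨hge, hfe⟩ hnot
      · rfl
    · simp only [hfs, hgs, if_true, if_false] at hfg
      exact absurd (hfg ▸ hg) hadα
    · simp only [hfs, hgs, if_true, if_false] at hfg
      exact absurd (hfg ▸ hf) hadα
    · simpa only [hfs, hgs, if_false] using hfg

end IsSurgery

theorem Relation.mkQ_eq_zero {k : ℕ} {r : FreeSpace n k} (h : Relation n k r) :
    (relations n k).mkQ r = 0 :=
  (Submodule.Quotient.mk_eq_zero _).2 (Submodule.subset_span h)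

/-- The relations rewrite a diagram with a dot on a nested arc in terms of diagrams for which the
sum of the depths of the dotted arcs is smaller, so the diagrams with dots on outer arcs span. -/
theorem mkQ_diagram_mem_span {k : ℕ} (β : CrossinglessMatching n) (S : Finset (Arc n))
    (hS : S ⊆ β.arcs) (hk : S.card = k) :
    (relations n k).mkQ (diagram k β S) ∈ Submodule.span ℤ[T;T⁻¹]
      (Set.range fun m : {m : DottedMatching n k // m.DotsOnOuterArcs} => cls m.1) := by
  induction hN : ∑ e ∈ S, depth β e using Nat.strong_induction_on generalizing β S with
  | _ N ih =>
  subst hN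
  by_cases hout : ∀ e ∈ S, ∀ f ∈ β.arcs, ¬ Encloses f e
  · rw [diagram, dif_pos ⟨hS, hk⟩]
    exact Submodule.subset_span ⟨⟨⟨β, S, hS, hk⟩, hout⟩, rfl⟩
  push Not at hout
  obtain ⟨⟨b, c⟩, hbcS, f, hf, hfe⟩ := hout
  -- `(a, d)` is the innermost arc around `(b, c)`.
  obtain ⟨⟨a, d⟩, had, hmax⟩ := Finset.exists_max_image
    (β.arcs.filter fun f => Encloses f (b, c)) (fun f => f.1) ⟨f, Finset.mem_filter.2 ⟨hf, hfe⟩⟩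
  obtain ⟨had, henc⟩ := Finset.mem_filter.1 had
  obtain ⟨α, h⟩ := exists_isSurgery had (hS hbcS) henc.1 henc.2 fun g hg h1 h2 =>
    absurd (hmax g (Finset.mem_filter.2 ⟨hg, h2⟩)) h1.1.not_ge
  have hlt := depth_lt_depth had henc
  by_cases hadS : (a, d) ∈ S
  · obtain ⟨D, hD⟩ : ∃ D, D = (S.erase (a, d)).erase (b, c) := ⟨_, rfl⟩
    have hne : (b, c) ≠ (a, d) := by rintro heq; rw [heq] at henc; exact lt_irrefl _ henc.1
    have hSD : S = insert (a, d) (insert (b, c) D) := by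
      rw [hD, Finset.insert_erase (Finset.mem_erase.2 ⟨hne, hbcS⟩), Finset.insert_erase hadS]
    have nbc : (b, c) ∉ D := by simp [hD]
    have nad : (a, d) ∉ D := by simp [hD]
    have nad' : (a, d) ∉ insert (b, c) D := by simp [nad, hne.symm]
    have hDβ : ∀ e ∈ D, e ∈ β.arcs ∧ e ≠ (a, d) ∧ e ≠ (b, c) := fun e he =>
      ⟨hS (by simp [hSD, he]), fun hh => nad (hh ▸ he), fun hh => nbc (hh ▸ he)⟩
    have hDα : ∀ e ∈ D, e ∈ α.arcs ∧ e ≠ (a, b) ∧ e ≠ (c, d) := fun e he =>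
      (h.mem_iff e).2 (hDβ e he)
    have nab : (a, b) ∉ D := fun hx => (hDα _ hx).2.1 rfl
    have ncd : (c, d) ∉ D := fun hx => (hDα _ hx).2.2 rfl
    have hne2 : (a, b) ≠ (c, d) := by simp [(h.a_lt_b.trans h.b_lt_c).ne]
    have nab' : (a, b) ∉ insert (c, d) D := by simp [nab, hne2]
    have hcard : D.card + 2 = k := by
      rw [← hk, hSD, Finset.card_insert_of_notMem nad', Finset.card_insert_of_notMem nbc]
    have hsum : ∑ x ∈ D, depth α x ≤ ∑ x ∈ D, depth β x :=
      Finset.sum_le_sum fun e he => h.depth_le (hDα e he).1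
    have hrel := (Relation.typeII α β a b c d D h (fun e he => by simpa using hDα e he)
      hcard).mkQ_eq_zero
    have hαmem : (relations n k).mkQ (diagram k α (insert (a, b) (insert (c, d) D))) ∈
        Submodule.span ℤ[T;T⁻¹]
          (Set.range fun m : {m : DottedMatching n k // m.DotsOnOuterArcs} => cls m.1) := by
      refine ih _ ?_ α _ (Finset.insert_subset h.ab_mem (Finset.insert_subset h.cd_mem
        fun e he => (hDα e he).1)) ?_ rfl
      · rw [hSD, Finset.sum_insert nad', Finset.sum_insert nbc, Finset.sum_insert nab',
          Finset.sum_insert ncd]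
        have := h.depth_ab_le
        have := h.depth_cd_le
        linarith
      · rw [Finset.card_insert_of_notMem nab', Finset.card_insert_of_notMem ncd, ← hcard]
    rw [typeII, map_sub, map_add, map_sum, sub_eq_zero, ← sub_eq_iff_eq_add] at hrel
    rw [hSD, ← hrel]
    refine Submodule.sub_mem _ hαmem (Submodule.sum_mem _ fun x hx => ?_)
    rw [map_smul]
    refine Submodule.smul_mem _ _ ?_
    have hx' : (x ∈ α.arcs ∧ x ∉ D) ∧ Encloses x (a, d) := by simpa [undottedAround] using hx
    have hxβ := (h.mem_iff_of_outside (Or.inl hx'.2.1)).1 hx'.1.1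
    have hxad : (a, d) ≠ x := by rintro rfl; exact lt_irrefl _ hx'.2.1
    have nad'' : (a, d) ∉ insert x D := by simp [nad, hxad]
    refine ih _ ?_ β _ (Finset.insert_subset had (Finset.insert_subset hxβ fun e he =>
      (hDβ e he).1)) ?_ rfl
    · rw [hSD, Finset.sum_insert nad', Finset.sum_insert nbc, Finset.sum_insert nad'',
          Finset.sum_insert hx'.1.2]
      have := depth_lt_depth hxβ hx'.2
      linarith
    · rw [Finset.card_insert_of_notMem nad'', Finset.card_insert_of_notMem hx'.1.2, ← hcard]
  · obtain ⟨D, hD⟩ : ∃ D, D = S.erase (b, c) := ⟨_, rfl⟩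
    have hSD : S = insert (b, c) D := by rw [hD, Finset.insert_erase hbcS]
    have nbc : (b, c) ∉ D := by simp [hD]
    have nad : (a, d) ∉ D := by simp [hD, hadS]
    have hDβ : ∀ e ∈ D, e ∈ β.arcs ∧ e ≠ (a, d) ∧ e ≠ (b, c) := fun e he =>
      ⟨hS (by simp [hSD, he]), fun hh => nad (hh ▸ he), fun hh => nbc (hh ▸ he)⟩
    have hDα : ∀ e ∈ D, e ∈ α.arcs ∧ e ≠ (a, b) ∧ e ≠ (c, d) := fun e he =>
      (h.mem_iff e).2 (hDβ e he)
    have nab : (a, b) ∉ D := fun hx => (hDα _ hx).2.1 rfl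
    have ncd : (c, d) ∉ D := fun hx => (hDα _ hx).2.2 rfl
    have hcard : ∀ x ∉ D, (insert x D).card = k := fun x hx => by
      rw [← hk, hSD, Finset.card_insert_of_notMem hx, Finset.card_insert_of_notMem nbc]
    have hsum : ∑ x ∈ D, depth α x ≤ ∑ x ∈ D, depth β x :=
      Finset.sum_le_sum fun e he => h.depth_le (hDα e he).1
    have hrel := (Relation.typeI α β a b c d D h (fun e he => by simpa using hDα e he)
      (by rw [← Finset.card_insert_of_notMem nbc, hcard _ nbc])).mkQ_eq_zero
    have hmem : ∀ x ∈ α.arcs, x ∉ D → depth α x ≤ depth β (a, d) →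
        (relations n k).mkQ (diagram k α (insert x D)) ∈ Submodule.span ℤ[T;T⁻¹]
          (Set.range fun m : {m : DottedMatching n k // m.DotsOnOuterArcs} => cls m.1) := by
      intro x hx hxD hxd
      refine ih _ ?_ α _ (Finset.insert_subset hx fun e he => (hDα e he).1) (hcard x hxD) rfl
      rw [hSD, Finset.sum_insert nbc, Finset.sum_insert hxD]
      linarith
    rw [typeI, map_sub, sub_eq_zero, map_add, map_add, map_add, map_smul, map_sum] at hrel
    rw [hSD, hrel]
    refine Submodule.add_mem _ (Submodule.add_mem _ (Submodule.add_mem _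
      (hmem _ h.ab_mem nab h.depth_ab_le) (hmem _ h.cd_mem ncd h.depth_cd_le))
      (Submodule.smul_mem _ _ ?_)) (Submodule.sum_mem _ fun x hx => ?_)
    · refine ih _ ?_ β _ (Finset.insert_subset had fun e he => (hDβ e he).1) (hcard _ nad) rfl
      rw [hSD, Finset.sum_insert nbc, Finset.sum_insert nad]
      omega
    · rw [map_smul]
      refine Submodule.smul_mem _ _ ?_
      have hx' : (x ∈ α.arcs ∧ x ∉ D) ∧ Encloses x (a, d) := by simpa [undottedAround] using hx
      have hxβ := (h.mem_iff_of_outside (Or.inl hx'.2.1)).1 hx'.1.1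
      refine hmem x hx'.1.1 hx'.1.2 ((h.depth_le hx'.1.1).trans
        (depth_lt_depth hxβ hx'.2).le)

theorem span_cls_eq_top (n k : ℕ) : Submodule.span ℤ[T;T⁻¹]
    (Set.range fun m : {m : DottedMatching n k // m.DotsOnOuterArcs} => cls m.1) = ⊤ := by
  refine eq_top_iff.2 fun x _ => ?_
  obtain ⟨v, rfl⟩ := (relations n k).mkQ_surjective x
  induction v using Finsupp.induction_linear with
  | zero => rw [map_zero]; exact Submodule.zero_mem _
  | add v w hv hw => rw [map_add]; exact Submodule.add_mem _ (hv trivial) (hw trivial)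
  | single m r =>
    have hm := mkQ_diagram_mem_span m.toCrossinglessMatching m.dots m.dots_subset m.card_dots
    rw [diagram, dif_pos ⟨m.dots_subset, m.card_dots⟩] at hm
    rw [← mul_one r, ← smul_eq_mul, ← Finsupp.smul_single, map_smul]
    exact Submodule.smul_mem _ _ hm
end QuantumRussell

/-! ### Smallest words -/

namespace QuantumRussell
open Polynomial
open CrossinglessMatching

/-- The coefficient of a word in an element of the word algebra. -/
noncomputable def wordCoeff (l : List Bool) : WordAlgebra →ₗ[ℤ[T;T⁻¹]] ℤ[T;T⁻¹] where
  toFun x := (show MonoidAlgebra ℤ[T;T⁻¹] (FreeMonoid Bool) from x).coeff (FreeMonoid.ofList l)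
  map_add' _ _ := rfl
  map_smul' _ _ := rfl

/-- If all words of `x` have length `L`, a word has at most one factorization that contributes to
its coefficient in `x * y`. -/
theorem wordCoeff_mul {x : WordAlgebra} {L : ℕ}
    (hx : ∀ l, wordCoeff l x ≠ 0 → l.length = L) (y : WordAlgebra) (m : List Bool) :
    wordCoeff m (x * y) = wordCoeff (m.take L) x * wordCoeff (m.drop L) y := by
  classical
  obtain ⟨x', rfl⟩ : ∃ x' : MonoidAlgebra ℤ[T;T⁻¹] (FreeMonoid Bool), x' = x := ⟨x, rfl⟩
  obtain ⟨y', rfl⟩ : ∃ y' : MonoidAlgebra ℤ[T;T⁻¹] (FreeMonoid Bool), y' = y := ⟨y, rfl⟩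
  change (x' * y').coeff (FreeMonoid.ofList m) =
    x'.coeff (FreeMonoid.ofList (m.take L)) * y'.coeff (FreeMonoid.ofList (m.drop L))
  rw [MonoidAlgebra.coeff_mul]
  have hsplit : ∀ u v : FreeMonoid Bool, u.toList.length = L → u * v = FreeMonoid.ofList m →
      u = FreeMonoid.ofList (m.take L) ∧ v = FreeMonoid.ofList (m.drop L) := by
    intro u v hu huv
    have h1 : u.toList ++ v.toList = m := by
      have := congrArg FreeMonoid.toList huv
      simpa using this
    subst h1
    subst hu
    simp
  have hsupp : ∀ u, x'.coeff u ≠ 0 → u.toList.length = L := fun u hu => hx u.toList hu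
  by_cases hm : x'.coeff (FreeMonoid.ofList (m.take L)) = 0
  · rw [hm, zero_mul]
    refine Finset.sum_eq_zero fun u hu => Finset.sum_eq_zero fun v hv => if_neg fun huv => ?_
    have hu' := Finsupp.mem_support_iff.1 hu
    have := (hsplit u v (hsupp u hu') huv).1
    exact hu' (this ▸ hm)
  · rw [Finsupp.sum, Finset.sum_eq_single (FreeMonoid.ofList (m.take L)), Finsupp.sum,
      Finset.sum_eq_single (FreeMonoid.ofList (m.drop L)), if_pos]
    · rw [← FreeMonoid.ofList_append, List.take_append_drop]
    · intro v _ hv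
      exact if_neg fun huv => hv (hsplit _ v (hsupp _ hm) huv).2
    · intro h0
      rw [Finsupp.notMem_support_iff.1 h0]; simp
    · intro u hu huu
      refine Finset.sum_eq_zero fun v hv => if_neg fun huv => ?_
      exact huu (hsplit u v (hsupp u (Finsupp.mem_support_iff.1 hu)) huv).1
    · intro h0
      exact absurd (Finsupp.notMem_support_iff.1 h0) hm

/-- The word `l` is the lexicographically smallest word of `x`, and all words of `x` have the same
length. -/
structure Leads (x : WordAlgebra) (l : List Bool) : Prop where
  ne_zero : wordCoeff l x ≠ 0
  length_eq : ∀ m, wordCoeff m x ≠ 0 → m.length = l.length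
  le : ∀ m, wordCoeff m x ≠ 0 → l ≤ m

theorem append_le_append {l l' m m' : List Bool} (h : l.length = l'.length) (hl : l ≤ l')
    (hm : m ≤ m') : l ++ m ≤ l' ++ m' := by
  induction l generalizing l' with
  | nil =>
    obtain rfl : l' = [] := List.length_eq_zero_iff.1 h.symm
    simpa using hm
  | cons a l ih =>
    cases l' with
    | nil => simp at h
    | cons b l' =>
      rw [← not_lt, List.cons_lt_cons_iff] at hl
      rw [List.cons_append, List.cons_append, ← not_lt, List.cons_lt_cons_iff]
      rintro (hab | ⟨rfl, hlt⟩)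
      · exact hl (Or.inl hab)
      · exact (ih (by simpa using h) (not_lt.1 fun h' => hl (Or.inr ⟨rfl, h'⟩))).not_gt hlt

namespace Leads

theorem mul {x y : WordAlgebra} {l m : List Bool} (hx : Leads x l) (hy : Leads y m) :
    Leads (x * y) (l ++ m) := by
  have key := wordCoeff_mul hx.length_eq y
  refine ⟨?_, fun w hw => ?_, fun w hw => ?_⟩
  · rw [key, List.take_left, List.drop_left]
    exact mul_ne_zero hx.ne_zero hy.ne_zero
  · rw [key] at hw
    have h1 := hx.length_eq _ (left_ne_zero_of_mul hw)
    have h2 := hy.length_eq _ (right_ne_zero_of_mul hw)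
    rw [List.length_append, ← h2]
    conv_lhs => rw [← List.take_append_drop l.length w, List.length_append, h1]
  · rw [key] at hw
    have h1 := hx.length_eq _ (left_ne_zero_of_mul hw)
    rw [← List.take_append_drop l.length w]
    exact append_le_append h1.symm (hx.le _ (left_ne_zero_of_mul hw))
      (hy.le _ (right_ne_zero_of_mul hw))

theorem of_single {x : WordAlgebra} {l : List Bool}
    (hx : x = MonoidAlgebra.single (FreeMonoid.ofList l) (1 : ℤ[T;T⁻¹])) : Leads x l := by
  have h : ∀ m, wordCoeff m x = if l = m then 1 else 0 := by
    intro m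
    subst hx
    change (Finsupp.single (FreeMonoid.ofList l) (1 : ℤ[T;T⁻¹])) (FreeMonoid.ofList m) = _
    by_cases hlm : l = m
    · subst hlm; simp
    · rw [if_neg hlm, Finsupp.single_eq_of_ne]
      exact fun hml => hlm (FreeMonoid.ofList.injective hml).symm
  refine ⟨by simp [h], fun m hm => ?_, fun m hm => ?_⟩ <;>
  · have : l = m := by by_contra hne; exact hm (by rw [h, if_neg hne])
    simp [this]

theorem one : Leads 1 [] := of_single rfl

theorem letter (b : Bool) : Leads (letter b) [b] := of_single rfl

theorem sandwich (b c : Bool) {x : WordAlgebra} {l : List Bool} (h : Leads x l) :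
    Leads (sandwich b c x) (b :: (l ++ [c])) := by
  have := ((letter b).mul h).mul (letter c)
  simpa [sandwich_apply] using this

theorem smul_sub {x y : WordAlgebra} {l m : List Bool} (hx : Leads x l) (hy : Leads y m)
    (hml : m < l) (hlen : l.length = m.length) (c : ℤ[T;T⁻¹]) : Leads (c • x - y) m := by
  have hx0 : wordCoeff m x = 0 := by
    by_contra h
    exact (hx.le m h).not_gt hml
  have hor : ∀ w, wordCoeff w (c • x - y) ≠ 0 → wordCoeff w x ≠ 0 ∨ wordCoeff w y ≠ 0 := by
    intro w hw
    by_contra hcon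
    push Not at hcon
    exact hw (by rw [map_sub, map_smul, hcon.1, hcon.2]; simp)
  refine ⟨?_, fun w hw => ?_, fun w hw => ?_⟩
  · rw [map_sub, map_smul, hx0, smul_zero, zero_sub]
    exact neg_ne_zero.2 hy.ne_zero
  · rcases hor w hw with h | h
    · rw [hx.length_eq w h, hlen]
    · exact hy.length_eq w h
  · rcases hor w hw with h | h
    · exact hml.le.trans (hx.le w h)
    · exact hy.le w h

end Leads

variable {n : ℕ}

open Classical in
/-- The indicator of the right endpoints of the undotted arcs. -/
noncomputable def isClosing (α : CrossinglessMatching n) (S : Finset (Arc n)) (p : ℕ) : Bool :=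
  decide (∃ e ∈ α.arcs, e ∉ S ∧ (e.2 : ℕ) = p)

theorem isClosing_iff {α : CrossinglessMatching n} {S : Finset (Arc n)} {p : ℕ} :
    isClosing α S p = true ↔ ∃ e ∈ α.arcs, e ∉ S ∧ (e.2 : ℕ) = p := by
  simp [isClosing]

/-- The word over the points of `[i, j)` that marks the right endpoints of the undotted arcs. -/
noncomputable def closingWord (α : CrossinglessMatching n) (S : Finset (Arc n)) (i j : ℕ) :
    List Bool :=
  (List.range' i (j - i)).map (isClosing α S)

theorem closingWord_arc {α : CrossinglessMatching n} {S : Finset (Arc n)} {e : Arc n}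
    (he : e ∈ α.arcs) {i j : ℕ} (hi : (e.1 : ℕ) = i) (hj : (e.2 : ℕ) < j) :
    closingWord α S i j = (false :: (closingWord α S (i + 1) e.2 ++ [decide (e ∉ S)])) ++
      closingWord α S (e.2 + 1) j := by
  have hlt : (e.1 : ℕ) < e.2 := α.fst_lt_snd e he
  have h1 : isClosing α S i = false := by
    rw [Bool.eq_false_iff, Ne, isClosing_iff]
    rintro ⟨f, hf, -, hfi⟩
    exact fst_ne_snd he hf (Fin.ext (by omega))
  have h2 : isClosing α S e.2 = decide (e ∉ S) := by
    rw [Bool.eq_iff_iff, isClosing_iff, decide_eq_true_iff]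
    constructor
    · rintro ⟨f, hf, hfS, h⟩
      rwa [eq_of_snd he hf (Fin.ext h.symm)]
    · exact fun h => ⟨e, he, h, rfl⟩
  have hr : List.range' i (j - i) = (i :: (List.range' (i + 1) (e.2 - (i + 1)) ++ [(e.2 : ℕ)])) ++
      List.range' (e.2 + 1) (j - (e.2 + 1)) := by
    have e1 : j - i = 1 + (e.2 - (i + 1)) + 1 + (j - (e.2 + 1)) := by omega
    rw [e1, ← List.range'_append_1, ← List.range'_append_1, ← List.range'_append_1]
    have e2 : i + (1 + (e.2 - (i + 1))) = e.2 := by omega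
    have e3 : i + (1 + (e.2 - (i + 1)) + 1) = e.2 + 1 := by omega
    rw [e2, e3]
    simp
  simp only [closingWord, hr, List.map_append, List.map_cons, List.map_nil, h1, h2]

theorem closingWord_of_le (α : CrossinglessMatching n) (S : Finset (Arc n)) {i j : ℕ}
    (h : j ≤ i) : closingWord α S i j = [] := by
  simp [closingWord, Nat.sub_eq_zero_of_le h]

theorem exists_weight_eq_C {α : CrossinglessMatching n} {S : Finset (Arc n)} {i j : ℕ}
    (hij : α.Closes i j) (hj : j ≤ 2 * n)
    (hS : ∀ e ∈ α.arcs, i ≤ e.1 → (e.2 : ℕ) < j → e ∉ S) :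
    ∃ x, weight α S i j = C x ∧ Leads x (closingWord α S i j) := by
  rcases le_or_gt j i with hle | hlt
  · exact ⟨1, by rw [weight_of_le α S hle, C_1], by rw [closingWord_of_le α S hle]; exact Leads.one⟩
  obtain ⟨e, he, hei, hej⟩ := hij.exists_arc hlt hj
  have hlt' : (e.1 : ℕ) < e.2 := α.fst_lt_snd e he
  subst hei
  have heS : e ∉ S := hS e he le_rfl hej
  obtain ⟨x, hx, hxl⟩ := exists_weight_eq_C (i := e.1 + 1) (j := e.2) (S := S)
    (Closes.inside he) (by omega) fun f hf h1 h2 => hS f hf (by omega) (by omega)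
  obtain ⟨y, hy, hyl⟩ := exists_weight_eq_C (i := e.2 + 1) (j := j) (S := S)
    (hij.after he rfl) hj fun f hf h1 h2 => hS f hf (by omega) (by omega)
  refine ⟨((LaurentPolynomial.T 1 : ℤ[T;T⁻¹]) • sandwich true false x - sandwich false true x) * y,
    ?_, ?_⟩
  · rw [weight_arc S he rfl hej, hx, hy, wrap, if_neg heS, plainWrap_C, C_mul, C_sub, smul_C]
  · rw [closingWord_arc he rfl hej]
    simp only [heS, not_false_iff, decide_true]
    refine ((hxl.sandwich true false).smul_sub (hxl.sandwich false true) ?_ (by simp) _).mul hyl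
    exact List.cons_lt_cons_iff.2 (Or.inl (by decide))
termination_by j - i

/-- When all dots lie on outer arcs, the constant term of the weight has the closing word as its
smallest word. -/
theorem leads_constTerm_weight {α : CrossinglessMatching n} {S : Finset (Arc n)} {i : ℕ}
    (hij : α.Closes i (2 * n)) (hS : ∀ e ∈ S, ∀ f ∈ α.arcs, ¬ Encloses f e) :
    Leads (constTerm (weight α S i (2 * n))) (closingWord α S i (2 * n)) := by
  rcases le_or_gt (2 * n) i with hle | hlt
  · rw [weight_of_le α S hle, closingWord_of_le α S hle, constTerm_apply, coeff_one_zero]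
    exact Leads.one
  obtain ⟨e, he, hei, hej⟩ := hij.exists_arc hlt le_rfl
  have hlt' : (e.1 : ℕ) < e.2 := α.fst_lt_snd e he
  subst hei
  obtain ⟨x, hx, hxl⟩ := exists_weight_eq_C (i := e.1 + 1) (j := e.2) (S := S)
    (Closes.inside he) (by omega) fun f _ h1 h2 hfS => hS f hfS e he ⟨h1, h2⟩
  have ih := leads_constTerm_weight (hij.after he rfl) hS
  rw [weight_arc S he rfl hej, hx, constTerm_apply, mul_coeff_zero, ← constTerm_apply,
    ← constTerm_apply (weight _ _ _ _), closingWord_arc he rfl hej]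
  refine Leads.mul ?_ ih
  by_cases heS : e ∈ S
  · rw [wrap, if_pos heS, dottedWrap_C, map_add, constTerm_X_mul, add_zero, constTerm_apply,
      coeff_C_zero]
    simpa [heS] using hxl.sandwich false false
  · rw [wrap, if_neg heS, plainWrap_C, map_sub, map_smul, constTerm_apply, constTerm_apply,
      coeff_C_zero, coeff_C_zero]
    simp only [heS, not_false_iff, decide_true]
    exact (hxl.sandwich true false).smul_sub (hxl.sandwich false true)
      (List.cons_lt_cons_iff.2 (Or.inl (by decide))) (by simp) _
termination_by 2 * n - i
end QuantumRussell

/-! ### Linear independence -/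

namespace QuantumRussell
open CrossinglessMatching

variable {n k : ℕ}

namespace DottedMatching

theorem eq_of_arcs_eq {m m' : DottedMatching n k} (h1 : m.arcs = m'.arcs) (h2 : m.dots = m'.dots) :
    m = m' := by
  obtain ⟨⟨A, _, _, _⟩, S, _, _⟩ := m
  obtain ⟨⟨A', _, _, _⟩, S', _, _⟩ := m'
  simp only at h1 h2
  subst h1
  subst h2
  rfl

/-- The undotted arcs. -/
def undotted (m : DottedMatching n k) : Finset (Arc n) := m.arcs \ m.dots

theorem mem_undotted {m : DottedMatching n k} {e : Arc n} :
    e ∈ m.undotted ↔ e ∈ m.arcs ∧ e ∉ m.dots := Finset.mem_sdiff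

/-- The right endpoints of the undotted arcs. -/
def closers (m : DottedMatching n k) : Finset ℕ := m.undotted.image fun e => (e.2 : ℕ)

theorem mem_closers {m : DottedMatching n k} {p : ℕ} :
    p ∈ m.closers ↔ ∃ e ∈ m.undotted, (e.2 : ℕ) = p := Finset.mem_image

/-- In a matching with dots on outer arcs no endpoint of a dotted arc lies under an arc. -/
theorem DotsOnOuterArcs.not_under {m : DottedMatching n k} (h : m.DotsOnOuterArcs) {e f : Arc n}
    (he : e ∈ m.dots) (hf : f ∈ m.arcs) {p : Fin (2 * n)} (hp : p = e.1 ∨ p = e.2)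
    (h1 : f.1 < p) : ¬ p < f.2 := fun h2 =>
  h e he f hf (encloses_of_endpoint (m.dots_subset he) hf hp h1 h2)

theorem exists_dotted_of_endpoint {m m' : DottedMatching n k} (hU : m.undotted = m'.undotted)
    {e : Arc n} (he : e ∈ m.dots) {p : Fin (2 * n)} (hp : p = e.1 ∨ p = e.2) :
    ∃ e' ∈ m'.dots, p = e'.1 ∨ p = e'.2 := by
  obtain ⟨e', he', hp'⟩ := m'.exists_arc p
  refine ⟨e', by_contra fun hd => ?_, hp'⟩
  have h1 : e' ∈ m.undotted := hU ▸ mem_undotted.2 ⟨he', hd⟩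
  have h2 := eq_of_endpoint (m.dots_subset he) (mem_undotted.1 h1).1 hp hp'
  exact (mem_undotted.1 h1).2 (h2 ▸ he)

theorem not_lt_of_undotted {m m' : DottedMatching n k} (h : m.DotsOnOuterArcs)
    {a a' d : Fin (2 * n)}
    (ih : ∀ e : Arc n, e.2 < d → e ∈ m.undotted → e ∈ m'.undotted)
    (he : (a, d) ∈ m.undotted) (he' : (a', d) ∈ m'.undotted) : ¬ a < a' := by
  intro haa
  have had' : a' < d := m'.fst_lt_snd _ (mem_undotted.1 he').1
  obtain ⟨f, hf, hp⟩ := m.exists_arc a'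
  have hfd : f ∉ m.dots := fun hfd =>
    h.not_under hfd (mem_undotted.1 he).1 hp haa had'
  have henc := encloses_of_endpoint hf (mem_undotted.1 he).1 hp haa had'
  have hf' := ih f henc.2 (mem_undotted.2 ⟨hf, hfd⟩)
  have := eq_of_endpoint (mem_undotted.1 hf').1 (mem_undotted.1 he').1 hp (Or.inl rfl)
  subst this
  exact lt_irrefl _ henc.2

theorem undotted_eq_of_closers_eq {m m' : DottedMatching n k} (h : m.DotsOnOuterArcs)
    (h' : m'.DotsOnOuterArcs) (hc : m.closers = m'.closers) : m.undotted = m'.undotted := by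
  have key : ∀ N : ℕ, ∀ e : Arc n, (e.2 : ℕ) = N → (e ∈ m.undotted ↔ e ∈ m'.undotted) := by
    intro N
    induction N using Nat.strong_induction_on with
    | _ N ih =>
    have ih1 : ∀ e : Arc n, (e.2 : ℕ) < N → e ∈ m.undotted → e ∈ m'.undotted :=
      fun e he => (ih _ he e rfl).1
    have ih2 : ∀ e : Arc n, (e.2 : ℕ) < N → e ∈ m'.undotted → e ∈ m.undotted :=
      fun e he => (ih _ he e rfl).2
    rintro ⟨a, d⟩ rfl
    constructor
    · intro he
      obtain ⟨⟨a', d'⟩, he', hd⟩ := mem_closers.1 (hc ▸ mem_closers.2 ⟨_, he, rfl⟩)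
      obtain rfl : d' = d := Fin.ext hd
      have h1 := not_lt_of_undotted h ih1 he he'
      have h2 := not_lt_of_undotted h' ih2 he' he
      obtain rfl : a = a' := le_antisymm (not_lt.1 h2) (not_lt.1 h1)
      exact he'
    · intro he'
      obtain ⟨⟨a', d'⟩, he, hd⟩ := mem_closers.1 (hc.symm ▸ mem_closers.2 ⟨_, he', rfl⟩)
      obtain rfl : d' = d := Fin.ext hd
      have h1 := not_lt_of_undotted h ih1 he he'
      have h2 := not_lt_of_undotted h' ih2 he' he
      obtain rfl : a = a' := le_antisymm (not_lt.1 h1) (not_lt.1 h2)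
      exact he
  ext e
  exact key _ e rfl

theorem mem_dots_of_mem_dots {m m' : DottedMatching n k} (h : m.DotsOnOuterArcs)
    (h' : m'.DotsOnOuterArcs) (hU : m.undotted = m'.undotted) {s t : Fin (2 * n)}
    (ih : ∀ e : Arc n, e.2 < t → e ∈ m'.dots → e ∈ m.dots) (he : (s, t) ∈ m.dots) :
    (s, t) ∈ m'.dots := by
  have hst : s < t := m.fst_lt_snd _ (m.dots_subset he)
  obtain ⟨⟨s', t'⟩, he', hp⟩ := exists_dotted_of_endpoint hU he (Or.inr (rfl : t = (s, t).2))
  obtain ⟨⟨u, v⟩, hf', hq⟩ := exists_dotted_of_endpoint hU he (Or.inl (rfl : s = (s, t).1))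
  have hlt' : s' < t' := m'.fst_lt_snd _ (m'.dots_subset he')
  have huv : u < v := m'.fst_lt_snd _ (m'.dots_subset hf')
  simp only at hp hq
  -- No dotted arc of `m'` has an endpoint strictly between `s` and `t`.
  have hbetween : ∀ p : Fin (2 * n), ∀ e' ∈ m'.dots, p = e'.1 ∨ p = e'.2 → s < p → ¬ p < t := by
    intro p e' he' hp h1
    obtain ⟨e, hed, hpe⟩ := exists_dotted_of_endpoint hU.symm he' hp
    exact h.not_under hed (m.dots_subset he) hpe h1
  rcases hq with rfl | rfl
  · have hv : ¬ v < t := hbetween v _ hf' (Or.inr rfl) huv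
    have hvt : ¬ t < v := h'.not_under he' (m'.dots_subset hf') hp hst
    obtain rfl : v = t := le_antisymm (not_lt.1 hvt) (not_lt.1 hv)
    exact hf'
  · have hf := ih _ hst hf'
    have := eq_of_endpoint (m.dots_subset hf) (m.dots_subset he) (Or.inr rfl) (Or.inl rfl)
    exact absurd (Prod.ext_iff.1 this).1 huv.ne

/-- A matching with dots on outer arcs is determined by the right endpoints of its undotted arcs:
the undotted arcs are found by matching parentheses, and the remaining points are joined in
consecutive pairs. -/
theorem eq_of_closers_eq {m m' : DottedMatching n k} (h : m.DotsOnOuterArcs)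
    (h' : m'.DotsOnOuterArcs) (hc : m.closers = m'.closers) : m = m' := by
  have hU := undotted_eq_of_closers_eq h h' hc
  have key : ∀ N : ℕ, ∀ e : Arc n, (e.2 : ℕ) = N → (e ∈ m.dots ↔ e ∈ m'.dots) := by
    intro N
    induction N using Nat.strong_induction_on with
    | _ N ih =>
    rintro ⟨s, t⟩ rfl
    exact ⟨mem_dots_of_mem_dots h h' hU fun e he => (ih _ he e rfl).2,
      mem_dots_of_mem_dots h' h hU.symm fun e he => (ih _ he e rfl).1⟩
  have hdots : m.dots = m'.dots := by
    ext e
    exact key _ e rfl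
  refine eq_of_arcs_eq ?_ hdots
  have hsdiff : m.arcs \ m.dots = m'.arcs \ m'.dots := hU
  rw [← Finset.sdiff_union_of_subset m.dots_subset, hsdiff, hdots,
    Finset.sdiff_union_of_subset m'.dots_subset]

theorem closers_eq_of_closingWord_eq {m m' : DottedMatching n k}
    (h : closingWord m.toCrossinglessMatching m.dots 0 (2 * n) =
      closingWord m'.toCrossinglessMatching m'.dots 0 (2 * n)) : m.closers = m'.closers := by
  have hmem : ∀ (m : DottedMatching n k) (p : ℕ),
      p ∈ m.closers ↔ isClosing m.toCrossinglessMatching m.dots p = true := by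
    intro m p
    simp only [mem_closers, isClosing_iff, mem_undotted, and_assoc]
  ext p
  rw [hmem, hmem]
  by_cases hp : p < 2 * n
  · have := List.map_inj_left.1 h p (by simpa using hp)
    rw [this]
  · have hno : ∀ m : DottedMatching n k,
        ¬ isClosing m.toCrossinglessMatching m.dots p = true := by
      intro m hm
      obtain ⟨e, -, -, he⟩ := isClosing_iff.1 hm
      exact hp (he ▸ e.2.isLt)
    simp [hno]

end DottedMatching

open DottedMatching

theorem linearIndependent_cls (n k : ℕ) : LinearIndependent ℤ[T;T⁻¹]
    (fun m : {m : DottedMatching n k // m.DotsOnOuterArcs} => cls m.1) := by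
  let φ : RussellSpace n k →ₗ[ℤ[T;T⁻¹]] WordAlgebra :=
    (relations n k).liftQ (eval n k) fun r hr => eval_eq_zero hr
  let w : {m : DottedMatching n k // m.DotsOnOuterArcs} → List Bool := fun m =>
    closingWord m.1.toCrossinglessMatching m.1.dots 0 (2 * n)
  have hφ : ∀ m : {m : DottedMatching n k // m.DotsOnOuterArcs}, Leads (φ (cls m.1)) (w m) := by
    intro m
    have h1 : φ (cls m.1) = eval n k (Finsupp.single m.1 1) := Submodule.liftQ_apply _ _ _
    rw [h1, eval_single]
    exact leads_constTerm_weight (closes_univ _) m.2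
  refine linearIndependent_iff.2 fun c hc => ?_
  by_contra hne
  -- The smallest word that occurs comes from a single diagram.
  obtain ⟨m₀, hm₀, hmin⟩ := Finset.exists_min_image c.support w (Finsupp.support_nonempty_iff.2 hne)
  have h0 := congrArg (wordCoeff (w m₀) ∘ₗ φ) hc
  rw [map_zero, Finsupp.linearCombination_apply, Finsupp.sum, map_sum,
    Finset.sum_eq_single m₀] at h0
  · rw [map_smul, smul_eq_mul] at h0
    exact mul_ne_zero (Finsupp.mem_support_iff.1 hm₀) (hφ m₀).ne_zero h0
  · intro m hm hmm
    rw [map_smul]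
    have hz : (wordCoeff (w m₀) ∘ₗ φ) (cls m.1) = 0 := by
      by_contra hnz
      have hle := (hφ m).le _ hnz
      have heq : w m = w m₀ := le_antisymm hle (hmin m hm)
      exact hmm (Subtype.ext (eq_of_closers_eq m.2 m₀.2 (closers_eq_of_closingWord_eq heq)))
    rw [hz, smul_zero]
  · exact fun h => absurd hm₀ h

theorem exists_basis_cls (n k : ℕ) :
    ∃ B : Module.Basis {m : DottedMatching n k // m.DotsOnOuterArcs} ℤ[T;T⁻¹] (RussellSpace n k),
      ∀ m, B m = cls m.1 :=
  ⟨Module.Basis.mk (linearIndependent_cls n k) (span_cls_eq_top n k).ge,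
    fun m => Module.Basis.mk_apply _ _ m⟩
end QuantumRussell

/-! ### The rank -/

namespace QuantumRussell
open Finset

open Classical in
/-- The subsets of `{0, …, N - 1}` with `j` elements that contain, for every `M ≤ N`, at most
half of the numbers below `M`. -/
noncomputable def ballot (N j : ℕ) : Finset (Finset ℕ) :=
  {S ∈ powersetCard j (range N) | ∀ M ∈ range (N + 1), 2 * #{x ∈ S | x < M} ≤ M}

theorem mem_ballot {N j : ℕ} {S : Finset ℕ} : S ∈ ballot N j ↔
    (∀ x ∈ S, x < N) ∧ #S = j ∧ ∀ M ≤ N, 2 * #{x ∈ S | x < M} ≤ M := by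
  simp [ballot, mem_powersetCard, subset_iff, and_assoc]

theorem card_ballot_zero (N : ℕ) : #(ballot N 0) = 1 := by
  rw [card_eq_one]
  refine ⟨∅, ?_⟩
  ext S
  rw [mem_ballot, mem_singleton]
  constructor
  · rintro ⟨-, h, -⟩
    exact card_eq_zero.1 h
  · rintro rfl
    simp

theorem ballot_eq_empty {N j : ℕ} (h : N < 2 * j) : ballot N j = ∅ := by
  refine eq_empty_of_forall_notMem fun S hS => ?_
  obtain ⟨h1, h2, h3⟩ := mem_ballot.1 hS
  have := h3 N le_rfl
  rw [filter_true_of_mem h1, h2] at this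
  omega

theorem card_ballot_succ_succ {N j : ℕ} (h : 2 * (j + 1) ≤ N + 1) :
    #(ballot (N + 1) (j + 1)) = #(ballot N (j + 1)) + #(ballot N j) := by
  have hN : ∀ {i} {S}, S ∈ ballot N i → N ∉ S := fun hS hNS =>
    lt_irrefl _ ((mem_ballot.1 hS).1 N hNS)
  have hfilter : ∀ (S : Finset ℕ) (M : ℕ), M ≤ N →
      {x ∈ insert N S | x < M} = {x ∈ S | x < M} := fun S M hM => by
    rw [filter_insert, if_neg (by omega)]
  have hdisj : Disjoint (ballot N (j + 1)) ((ballot N j).image (insert N)) := by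
    refine disjoint_left.2 fun S hS hS' => ?_
    obtain ⟨S', -, rfl⟩ := mem_image.1 hS'
    exact hN hS (mem_insert_self _ _)
  have hinj : Set.InjOn (insert N) (ballot N j : Set (Finset ℕ)) := by
    intro S hS S' hS' heq
    rw [← erase_insert (hN hS), ← erase_insert (hN hS')]
    exact congrArg (fun s => s.erase N) heq
  rw [← card_image_of_injOn hinj, ← card_union_of_disjoint hdisj]
  congr 1
  ext S
  rw [mem_union, mem_image]
  constructor
  · intro hS
    obtain ⟨h1, h2, h3⟩ := mem_ballot.1 hS
    by_cases hNS : N ∈ S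
    · refine Or.inr ⟨S.erase N, mem_ballot.2 ⟨fun x hx => ?_, ?_, fun M hM => ?_⟩, insert_erase hNS⟩
      · have := h1 x (mem_of_mem_erase hx)
        have := ne_of_mem_erase hx
        omega
      · rw [card_erase_of_mem hNS, h2]; rfl
      · rw [← hfilter _ M hM, insert_erase hNS]
        exact h3 M (by omega)
    · refine Or.inl (mem_ballot.2 ⟨fun x hx => ?_, h2, fun M hM => h3 M (by omega)⟩)
      have := h1 x hx
      have : x ≠ N := fun hxN => hNS (hxN ▸ hx)
      omega
  · rintro (hS | ⟨S, hS, rfl⟩)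
    · obtain ⟨h1, h2, h3⟩ := mem_ballot.1 hS
      refine mem_ballot.2 ⟨fun x hx => (h1 x hx).trans (Nat.lt_succ_self _), h2, fun M hM => ?_⟩
      rcases Nat.le_succ_iff.1 hM with hM | rfl
      · exact h3 M hM
      · exact (Nat.mul_le_mul_left 2 (card_filter_le _ _)).trans (h2 ▸ h)
    · obtain ⟨h1, h2, h3⟩ := mem_ballot.1 hS
      refine mem_ballot.2
          ⟨fun x hx => ?_, by rw [card_insert_of_notMem (hN hS), h2], fun M hM => ?_⟩
      · rcases mem_insert.1 hx with rfl | hx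
        · exact Nat.lt_succ_self _
        · exact (h1 x hx).trans (Nat.lt_succ_self _)
      · rcases Nat.le_succ_iff.1 hM with hM | rfl
        · rw [hfilter _ M hM]
          exact h3 M hM
        · refine (Nat.mul_le_mul_left 2 (card_filter_le _ _)).trans ?_
          rw [card_insert_of_notMem (hN hS), h2]
          exact h

/-- The ballot numbers. -/
theorem card_ballot_succ_add {N j : ℕ} (h : 2 * (j + 1) ≤ N + 1) :
    #(ballot N (j + 1)) + N.choose j = N.choose (j + 1) := by
  induction N generalizing j with
  | zero => omega
  | succ N ih =>
    rcases h.eq_or_lt with h | h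
    · rw [ballot_eq_empty (by omega), card_empty, zero_add]
      exact Nat.choose_symm_of_eq_add (by omega)
    · rw [card_ballot_succ_succ (by omega), Nat.choose_succ_succ', ← ih (j := j) (by omega)]
      cases j with
      | zero => simp [card_ballot_zero]; omega
      | succ j =>
        have := ih (j := j) (by omega)
        rw [Nat.choose_succ_succ']
        omega

theorem card_ballot_two_mul {n k : ℕ} (hk : k ≤ n) :
    #(ballot (2 * n) (n - k)) + (2 * n).choose (n + k + 1) = (2 * n).choose (n + k) := by
  have h1 : (2 * n).choose (n + k) = (2 * n).choose (n - k) :=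
    Nat.choose_symm_of_eq_add (by omega)
  rcases hk.eq_or_lt with rfl | hlt
  · rw [Nat.sub_self, card_ballot_zero, Nat.choose_eq_zero_of_lt (by omega), ← two_mul,
      Nat.choose_self]
  · obtain ⟨j, hj⟩ : ∃ j, n - k = j + 1 := ⟨n - k - 1, by omega⟩
    have h2 : (2 * n).choose (n + k + 1) = (2 * n).choose j :=
      Nat.choose_symm_of_eq_add (by omega)
    rw [h1, h2, hj]
    exact card_ballot_succ_add (by omega)

theorem ballot_number_eq {n k : ℕ} (hk : k ≤ n) :
    ((2 * n).choose (n + k) : ℚ) - (2 * n).choose (n + k + 1) =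
      (2 * k + 1 : ℚ) / (n + k + 1 : ℚ) * ((2 * n).choose (n + k) : ℚ) := by
  have h := Nat.choose_succ_right_eq (2 * n) (n + k)
  have hsub : 2 * n - (n + k) = n - k := by omega
  rw [hsub] at h
  have hq : ((2 * n).choose (n + k + 1) : ℚ) * (n + k + 1) = (2 * n).choose (n + k) * (n - k) := by
    have := congrArg (Nat.cast : ℕ → ℚ) h
    push_cast [Nat.cast_sub hk] at this
    exact this
  have hpos : (n + k + 1 : ℚ) ≠ 0 := by positivity
  field_simp
  linear_combination -hq

variable {n : ℕ}

/-- The endpoints of the arcs in `A`. -/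
def endpoints (A : Finset (Arc n)) : Finset (Fin (2 * n)) := A.image Prod.fst ∪ A.image Prod.snd

theorem mem_endpoints {A : Finset (Arc n)} {p : Fin (2 * n)} :
    p ∈ endpoints A ↔ ∃ e ∈ A, p = e.1 ∨ p = e.2 := by
  simp only [endpoints, mem_union, mem_image]
  constructor
  · rintro (⟨e, he, rfl⟩ | ⟨e, he, rfl⟩)
    exacts [⟨e, he, Or.inl rfl⟩, ⟨e, he, Or.inr rfl⟩]
  · rintro ⟨e, he, rfl | rfl⟩
    exacts [Or.inl ⟨e, he, rfl⟩, Or.inr ⟨e, he, rfl⟩]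

/-- A set of arcs without common endpoints, no two of which cross. -/
structure IsPartialMatching (A : Finset (Arc n)) : Prop where
  fst_lt_snd : ∀ e ∈ A, e.1 < e.2
  eq_of_endpoint : ∀ e ∈ A, ∀ f ∈ A, ∀ p, (p = e.1 ∨ p = e.2) → (p = f.1 ∨ p = f.2) → e = f
  not_cross : ∀ e ∈ A, ∀ f ∈ A, ¬ (e.1 < f.1 ∧ f.1 < e.2 ∧ e.2 < f.2)

theorem CrossinglessMatching.isPartialMatching (α : CrossinglessMatching n) {A : Finset (Arc n)}
    (hA : A ⊆ α.arcs) : IsPartialMatching A where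
  fst_lt_snd e he := α.fst_lt_snd e (hA he)
  eq_of_endpoint _ he _ hf _ h1 h2 := CrossinglessMatching.eq_of_endpoint (hA he) (hA hf) h1 h2
  not_cross e he f hf := α.not_cross e (hA he) f (hA hf)

namespace IsPartialMatching

variable {A : Finset (Arc n)}

theorem card_endpoints (h : IsPartialMatching A) : #(endpoints A) = 2 * #A := by
  rw [endpoints, card_union_of_disjoint, card_image_of_injOn, card_image_of_injOn]
  · omega
  · exact fun e he f hf hef => h.eq_of_endpoint e he f hf e.2 (Or.inr rfl) (Or.inr hef)
  · exact fun e he f hf hef => h.eq_of_endpoint e he f hf e.1 (Or.inl rfl) (Or.inl hef)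
  · refine disjoint_left.2 fun p hp hp' => ?_
    obtain ⟨e, he, rfl⟩ := mem_image.1 hp
    obtain ⟨f, hf, hef⟩ := mem_image.1 hp'
    obtain rfl := h.eq_of_endpoint e he f hf e.1 (Or.inl rfl) (Or.inr hef.symm)
    exact (h.fst_lt_snd e he).ne' hef

/-- Two points that are not endpoints and do not lie under an arc can be joined by a new arc. -/
theorem insert (h : IsPartialMatching A) {s t : Fin (2 * n)} (hst : s < t)
    (hs : s ∉ endpoints A) (ht : t ∉ endpoints A) (hs' : ∀ e ∈ A, ¬ (e.1 < s ∧ s < e.2))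
    (ht' : ∀ e ∈ A, ¬ (e.1 < t ∧ t < e.2)) : IsPartialMatching (insert (s, t) A) := by
  have hends : ∀ e ∈ A, ∀ p, (p = s ∨ p = t) → ¬ (p = e.1 ∨ p = e.2) := by
    rintro e he p (rfl | rfl) hp
    exacts [hs (mem_endpoints.2 ⟨e, he, hp⟩), ht (mem_endpoints.2 ⟨e, he, hp⟩)]
  refine ⟨fun e he => ?_, fun e he f hf p hpe hpf => ?_, fun e he f hf => ?_⟩
  · rcases mem_insert.1 he with rfl | he
    exacts [hst, h.fst_lt_snd e he]
  · rcases mem_insert.1 he with rfl | he <;> rcases mem_insert.1 hf with rfl | hf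
    · rfl
    · exact absurd hpf (hends f hf p hpe)
    · exact absurd hpe (hends e he p hpf)
    · exact h.eq_of_endpoint e he f hf p hpe hpf
  · rcases mem_insert.1 he with rfl | he <;> rcases mem_insert.1 hf with rfl | hf
    · exact fun hc => lt_irrefl _ hc.1
    · exact fun hc => ht' f hf ⟨hc.2.1, hc.2.2⟩
    · exact fun hc => hs' e he ⟨hc.1, hc.2.1⟩
    · exact h.not_cross e he f hf

end IsPartialMatching

theorem endpoints_insert (A : Finset (Arc n)) (s t : Fin (2 * n)) :
    endpoints (insert (s, t) A) = insert s (insert t (endpoints A)) := by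
  ext p
  simp only [mem_endpoints, mem_insert, exists_eq_or_imp, or_assoc]

/-- Read from left to right, every point in a ballot set is joined to the nearest point on its left
that is still free and not in the set. -/
theorem exists_isPartialMatching {S : Finset ℕ} {j : ℕ} (hS : S ∈ ballot (2 * n) j) (N : ℕ)
    (hN : N ≤ 2 * n) : ∃ A : Finset (Arc n), IsPartialMatching A ∧ (∀ e ∈ A, (e.2 : ℕ) < N) ∧
      (∀ p : Fin (2 * n), (p : ℕ) < N → ((p : ℕ) ∈ S ↔ ∃ e ∈ A, e.2 = p)) ∧
      ∀ p : Fin (2 * n), (p : ℕ) < N → p ∉ endpoints A → ∀ e ∈ A, ¬ (e.1 < p ∧ p < e.2) := by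
  induction N with
  | zero => exact ⟨∅, ⟨by simp, by simp, by simp⟩, by simp, by simp, by simp⟩
  | succ N ih =>
    obtain ⟨A, hA, hlt, hmem, hexp⟩ := ih (by omega)
    have hcov : ∀ p : Fin (2 * n), p ∈ endpoints A → (p : ℕ) < N := by
      intro p hp
      obtain ⟨e, he, rfl | rfl⟩ := mem_endpoints.1 hp
      · exact (show (e.1 : ℕ) < e.2 from hA.fst_lt_snd e he).trans (hlt e he)
      · exact hlt e he
    let t : Fin (2 * n) := ⟨N, by omega⟩
    have ht : t ∉ endpoints A := fun h => lt_irrefl _ (hcov t h)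
    have htexp : ∀ e ∈ A, ¬ (e.1 < t ∧ t < e.2) := fun e he h =>
      absurd (hlt e he) (show N < e.2 from h.2).le.not_gt
    have hpt : ∀ p : Fin (2 * n), (p : ℕ) < N + 1 → (p : ℕ) < N ∨ p = t := by
      intro p hp
      rcases Nat.lt_succ_iff_lt_or_eq.1 hp with h | h
      exacts [Or.inl h, Or.inr (Fin.ext h)]
    by_cases hNS : N ∈ S
    -- There is a free point to the left of `N`: otherwise `N` points would be endpoints of fewer
    -- than `N / 2` arcs, by the ballot condition on the first `N + 1` points.
    · have hfree : ({p : Fin (2 * n) | (p : ℕ) < N ∧ p ∉ endpoints A} : Finset _).Nonempty := by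
        rw [nonempty_iff_ne_empty]
        intro hempty
        have h1 : N ≤ #(endpoints A) := by
          have hsub : range N ⊆ (endpoints A).image fun p : Fin (2 * n) => (p : ℕ) := by
            intro x hx
            have hx := mem_range.1 hx
            refine mem_image.2 ⟨⟨x, by omega⟩, ?_, rfl⟩
            by_contra hcon
            have : (⟨x, by omega⟩ : Fin (2 * n)) ∈
                ({p : Fin (2 * n) | (p : ℕ) < N ∧ p ∉ endpoints A} : Finset _) := by
              simp [hx, hcon]
            rw [hempty] at this
            simp at this
          have := (card_le_card hsub).trans card_image_le
          simpa using this
        have h2 : #A ≤ #{x ∈ S | x < N} := by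
          refine card_le_card_of_injOn (fun e => (e.2 : ℕ)) (fun e he => ?_) fun e he f hf hef => ?_
          · exact mem_filter.2 ⟨(hmem _ (hlt e he)).2 ⟨e, he, rfl⟩, hlt e he⟩
          · exact hA.eq_of_endpoint e he f hf e.2 (Or.inr rfl) (Or.inr (Fin.ext hef))
        have h3 := (mem_ballot.1 hS).2.2 (N + 1) hN
        have h4 : {x ∈ S | x < N + 1} = Insert.insert N {x ∈ S | x < N} := by
          ext x
          simp only [mem_filter, mem_insert, Nat.lt_succ_iff_lt_or_eq]
          constructor
          · rintro ⟨hx, h | h⟩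
            exacts [Or.inr ⟨hx, h⟩, Or.inl h]
          · rintro (rfl | ⟨hx, h⟩)
            exacts [⟨hNS, Or.inr rfl⟩, ⟨hx, Or.inl h⟩]
        rw [h4, card_insert_of_notMem (by simp)] at h3
        rw [hA.card_endpoints] at h1
        omega
      obtain ⟨s, hs, hmax⟩ := exists_max_image _ id hfree
      obtain ⟨hsN, hs⟩ := (mem_filter.1 hs).2
      refine ⟨insert (s, t) A, hA.insert hsN hs ht (hexp s hsN hs) htexp, ?_, ?_, ?_⟩
      · intro e he
        rcases mem_insert.1 he with rfl | he
        exacts [Nat.lt_succ_self N, (hlt e he).trans (Nat.lt_succ_self N)]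
      · intro p hp
        rcases hpt p hp with h | rfl
        · rw [hmem p h]
          constructor
          · rintro ⟨e, he, rfl⟩
            exact ⟨e, mem_insert_of_mem he, rfl⟩
          · rintro ⟨e, he, rfl⟩
            rcases mem_insert.1 he with rfl | he
            · exact absurd h (lt_irrefl _)
            · exact ⟨e, he, rfl⟩
        · exact ⟨fun _ => ⟨_, mem_insert_self _ _, rfl⟩, fun _ => hNS⟩
      · intro p hp hpe e he
        rw [endpoints_insert, mem_insert, mem_insert, not_or, not_or] at hpe
        have hpN : (p : ℕ) < N := (hpt p hp).resolve_right hpe.2.1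
        rcases mem_insert.1 he with rfl | he
        · have hle : p ≤ s := hmax p (by simp [hpN, hpe.2.2])
          exact fun hc => hc.1.not_ge hle
        · exact hexp p hpN hpe.2.2 e he
    · refine ⟨A, hA, fun e he => (hlt e he).trans (Nat.lt_succ_self N), fun p hp => ?_,
        fun p hp hpe => ?_⟩
      · rcases hpt p hp with h | rfl
        · exact hmem p h
        · refine ⟨fun h => absurd h hNS, ?_⟩
          rintro ⟨e, he, het⟩
          exact absurd (mem_endpoints.2 ⟨e, he, Or.inr het.symm⟩) ht
      · rcases hpt p hp with h | rfl
        exacts [hexp p h hpe, htexp]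

/-- The free points are joined in consecutive pairs, from right to left, by dotted arcs. -/
theorem exists_perfect (A E : Finset (Arc n)) (hA : IsPartialMatching A) (hE : E ⊆ A)
    (hexp : ∀ p, p ∉ endpoints A → ∀ e ∈ A, ¬ (e.1 < p ∧ p < e.2))
    (hout : ∀ e ∈ E, ∀ f ∈ A, ¬ Encloses f e)
    (hright : ∀ e ∈ E, ∀ p, p ∉ endpoints A → p < e.1) :
    ∃ A' E' : Finset (Arc n), IsPartialMatching A' ∧ E' ⊆ A' ∧ A' \ E' = A \ E ∧
      endpoints A' = univ ∧ ∀ e ∈ E', ∀ f ∈ A', ¬ Encloses f e := by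
  by_cases hfull : endpoints A = univ
  · exact ⟨A, E, hA, hE, rfl, hfull, hout⟩
  have hcard := hA.card_endpoints
  have hcompl : #(endpoints A)ᶜ = 2 * n - 2 * #A := by
    rw [card_compl, hcard, Fintype.card_fin]
  have hne : (endpoints A)ᶜ.Nonempty := by
    rw [nonempty_iff_ne_empty, Ne, compl_eq_empty_iff]
    exact hfull
  have hpos := hne.card_pos
  obtain ⟨t, ht, htmax⟩ := exists_max_image _ id hne
  -- The number of free points is even.
  have hne' : ((endpoints A)ᶜ.erase t).Nonempty := by
    rw [← card_pos, card_erase_of_mem ht]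
    omega
  obtain ⟨s, hs, hsmax⟩ := exists_max_image _ id hne'
  have hst : s < t := lt_of_le_of_ne (htmax s (mem_of_mem_erase hs)) (ne_of_mem_erase hs)
  have hs0 : s ∉ endpoints A := by simpa using mem_of_mem_erase hs
  have ht0 : t ∉ endpoints A := by simpa using ht
  have hfree : ∀ p, p ∉ endpoints (insert (s, t) A) → p < s ∧ p ∉ endpoints A := by
    intro p hp
    rw [endpoints_insert, mem_insert, mem_insert, not_or, not_or] at hp
    exact ⟨lt_of_le_of_ne (hsmax p (mem_erase.2 ⟨hp.2.1, mem_compl.2 hp.2.2⟩)) hp.1, hp.2.2⟩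
  have hstA : (s, t) ∉ A := fun h => hs0 (mem_endpoints.2 ⟨_, h, Or.inl rfl⟩)
  have hA' := hA.insert hst hs0 ht0 (hexp s hs0) (hexp t ht0)
  obtain ⟨A', E', h1, h2, h3, h4⟩ := exists_perfect (insert (s, t) A) (insert (s, t) E) hA'
    (insert_subset_insert _ hE)
    (by
      intro p hp e he
      obtain ⟨hps, hp⟩ := hfree p hp
      rcases mem_insert.1 he with rfl | he
      exacts [fun hc => lt_asymm hps hc.1, hexp p hp e he])
    (by
      intro e he f hf
      rcases mem_insert.1 he with rfl | he <;> rcases mem_insert.1 hf with rfl | hf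
      · exact fun hc => lt_irrefl _ hc.1
      · exact fun hc => hexp s hs0 f hf ⟨hc.1, hst.trans hc.2⟩
      · exact fun hc => lt_asymm hc.2 ((hright e he t ht0).trans (hA.fst_lt_snd e (hE he)))
      · exact hout e he f hf)
    (by
      intro e he p hp
      obtain ⟨hps, hp⟩ := hfree p hp
      rcases mem_insert.1 he with rfl | he
      exacts [hps, hright e he p hp])
  refine ⟨A', E', h1, h2, h3.trans ?_, h4⟩
  ext e
  simp only [mem_sdiff, mem_insert, not_or]
  constructor
  · rintro ⟨rfl | h, h', h''⟩
    exacts [absurd rfl h', ⟨h, h''⟩]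
  · rintro ⟨h, h'⟩
    exact ⟨Or.inr h, fun heq => hstA (heq ▸ h), h'⟩
termination_by 2 * n - #(endpoints A)
decreasing_by
  rw [hA'.card_endpoints, hA.card_endpoints, card_insert_of_notMem hstA]
  omega

theorem CrossinglessMatching.card_arcs (α : CrossinglessMatching n) : #α.arcs = n := by
  have h1 := (α.isPartialMatching Subset.rfl).card_endpoints
  have h2 : endpoints α.arcs = univ := eq_univ_of_forall fun p => mem_endpoints.2 (α.exists_arc p)
  rw [h2, card_univ, Fintype.card_fin] at h1
  omega

namespace DottedMatching

variable {k : ℕ}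

theorem closers_mem_ballot (m : DottedMatching n k) : m.closers ∈ ballot (2 * n) (n - k) := by
  have hU : m.undotted ⊆ m.arcs := sdiff_subset
  have hinj : Set.InjOn (fun e : Arc n => (e.2 : ℕ)) (m.undotted : Set (Arc n)) :=
    fun e he f hf hef => CrossinglessMatching.eq_of_snd (hU he) (hU hf) (Fin.ext hef)
  refine mem_ballot.2 ⟨fun x hx => ?_, ?_, fun M _ => ?_⟩
  · obtain ⟨e, -, rfl⟩ := mem_closers.1 hx
    exact e.2.isLt
  · rw [closers, card_image_of_injOn hinj, undotted, card_sdiff_of_subset m.dots_subset,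
      m.card_dots, m.card_arcs]
  · have h1 : #{x ∈ m.closers | x < M} ≤ #{e ∈ m.undotted | (e.2 : ℕ) < M} := by
      rw [closers, filter_image]
      exact card_image_le
    have h2 := (m.isPartialMatching ((filter_subset (fun e => (e.2 : ℕ) < M) _).trans
      hU)).card_endpoints
    have h3 : #(endpoints {e ∈ m.undotted | (e.2 : ℕ) < M}) ≤ #(range M) := by
      refine card_le_card_of_injOn (fun p => (p : ℕ)) (fun p hp => ?_) fun p _ q _ h => Fin.ext h
      obtain ⟨e, he, hp⟩ := mem_endpoints.1 hp
      obtain ⟨he, heM⟩ := mem_filter.1 he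
      have hlt : (e.1 : ℕ) < e.2 := m.fst_lt_snd e (hU he)
      rcases hp with rfl | rfl <;> simp only [coe_range, Set.mem_Iio] <;> omega
    rw [card_range] at h3
    omega

theorem exists_closers_eq (hk : k ≤ n) {S : Finset ℕ} (hS : S ∈ ballot (2 * n) (n - k)) :
    ∃ m : DottedMatching n k, m.DotsOnOuterArcs ∧ m.closers = S := by
  obtain ⟨A₀, hA₀, -, hmem, hexp⟩ := exists_isPartialMatching hS (2 * n) le_rfl
  obtain ⟨A, E, hA, hE, hAE, hfull, hout⟩ := exists_perfect A₀ ∅ hA₀ (empty_subset _)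
    (fun p => hexp p p.isLt) (by simp) (by simp)
  rw [sdiff_empty] at hAE
  let α : CrossinglessMatching n :=
    { arcs := A
      fst_lt_snd := hA.fst_lt_snd
      existsUnique_arc := fun p => by
        obtain ⟨e, he, hp⟩ := mem_endpoints.1 (hfull ▸ mem_univ p)
        exact ⟨e, ⟨he, hp⟩, fun f hf => hA.eq_of_endpoint f hf.1 e he p hf.2 hp⟩
      not_cross := hA.not_cross }
  have himage : A₀.image (fun e => (e.2 : ℕ)) = S := by
    ext x
    rw [mem_image]
    constructor
    · rintro ⟨e, he, rfl⟩
      exact (hmem e.2 e.2.isLt).2 ⟨e, he, rfl⟩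
    · intro hx
      obtain ⟨e, he, hex⟩ := (hmem ⟨x, (mem_ballot.1 hS).1 x hx⟩
        ((mem_ballot.1 hS).1 x hx)).1 hx
      exact ⟨e, he, by rw [hex]⟩
  have hcard₀ : #A₀ = n - k := by
    rw [← (mem_ballot.1 hS).2.1, ← himage, card_image_of_injOn]
    exact fun e he f hf hef =>
      hA₀.eq_of_endpoint e he f hf e.2 (Or.inr rfl) (Or.inr (Fin.ext hef))
  have hcardA : #A = n := α.card_arcs
  have hcardE : #E = k := by
    have := card_sdiff_add_card_eq_card hE
    rw [hAE] at this
    omega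
  refine ⟨{ α with dots := E, dots_subset := hE, card_dots := hcardE }, hout, ?_⟩
  rw [← himage, ← hAE]
  rfl

theorem card_dotsOnOuterArcs (hk : k ≤ n) :
    Nat.card {m : DottedMatching n k // m.DotsOnOuterArcs} = #(ballot (2 * n) (n - k)) := by
  rw [← Nat.card_eq_finsetCard]
  refine Nat.card_congr (Equiv.ofBijective (fun m => ⟨m.1.closers, m.1.closers_mem_ballot⟩)
    ⟨fun m m' h => ?_, fun S => ?_⟩)
  · exact Subtype.ext (eq_of_closers_eq m.2 m'.2 (congrArg Subtype.val h))
  · obtain ⟨m, hm, h⟩ := exists_closers_eq hk S.2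
    exact ⟨⟨m, hm⟩, Subtype.ext h⟩

end DottedMatching

theorem finrank_russellSpace (n k : ℕ) (hk : k ≤ n) :
    Module.finrank ℤ[T;T⁻¹] (RussellSpace n k) = #(ballot (2 * n) (n - k)) := by
  obtain ⟨B, -⟩ := exists_basis_cls n k
  rw [Module.finrank_eq_nat_card_basis B, DottedMatching.card_dotsOnOuterArcs hk]

end QuantumRussell

theorem mainTheorem4 (n k : ℕ) (hk : k ≤ n) :
    (∃ B : Module.Basis {m : QuantumRussell.DottedMatching n k // m.DotsOnOuterArcs}
        (LaurentPolynomial ℤ) (QuantumRussell.RussellSpace n k),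
      ∀ m, B m = QuantumRussell.cls m.1) ∧
    (Module.finrank (LaurentPolynomial ℤ) (QuantumRussell.RussellSpace n k) : ℤ) =
      ((2 * n).choose (n + k) : ℤ) - ((2 * n).choose (n + k + 1) : ℤ) ∧
    (Module.finrank (LaurentPolynomial ℤ) (QuantumRussell.RussellSpace n k) : ℚ) =
      (2 * k + 1 : ℚ) / (n + k + 1 : ℚ) * ((2 * n).choose (n + k) : ℚ) := by
  have hcard := QuantumRussell.card_ballot_two_mul hk
  refine ⟨QuantumRussell.exists_basis_cls n k, ?_, ?_⟩
  · rw [QuantumRussell.finrank_russellSpace n k hk, ← hcard]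
    push_cast
    ring
  · rw [QuantumRussell.finrank_russellSpace n k hk, ← QuantumRussell.ballot_number_eq hk, ← hcard]
    push_cast
    ring
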